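/- Let $S$ be a Noetherian commutative ring, $G$ an abelian group, $\gamma_1,\dots,\gamma_n\in G$, and let $R=S[X_1,\dots,X_n]$ be $G$-graded by $\deg X_k=\gamma_k$, $\deg s=0$ for $s\in S$. Let $B\subseteq (X_1,\dots,X_n)$ be an ideal generated by finitely many homogeneous elements, and assume that every monomial $X^a\neq 1$ of degree $0$ lies in the radical $\sqrt B$ (this holds in particular if $1$ is the only monomial of degree $0$, i.e. $R_0=S$). For a graded $R$-module $N$ put $\mathrm{Supp}_G(N)=\{\gamma\in G: N_\gamma\ne 0\}$. Let $\mathcal C\subseteq G$ be the submonoid generated by $\gamma_1,\dots,\gamma_n$ and, for $i\ge 0$, $\mathcal E_i=\{\gamma_{k_1}+\dots+\gamma_{k_i}: k_1<\dots<k_i\}$ (so $\mathcal E_0=\{0\}$, and $\mathcal E_i=\emptyset$ for $i>n$). For $\ell\in\mathbb Z$ and a graded $R$-module $N$ put $$\mathrm{reg}^\ell(N)=\Big\{\gamma\in G:\ \forall c\in\mathcal C,\ \gamma+c\notin\bigcup_{i\ge \ell}\big(\mathrm{Supp}_G(H^i_B(N))+\mathcal E_i\big)\Big\},$$ where $H^i_B$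 denotes local cohomology, and let $\mathrm{cd}_B(R)=\sup\{i: H^i_B(R)\neq 0\}$. Let $M$ be a finitely generated $G$-graded $R$-module and $T_i=\mathrm{Supp}_G(\mathrm{Tor}_i^R(M,S))$, where $S=R/(X_1,\dots,X_n)$. An intersection over an empty index set is $G$. Then for every $\ell\in\mathbb Z$: (1) If $\mathrm{cd}_B(R)\le n$, then $$\mathrm{reg}^\ell(M)\supseteq\bigcap_{0\le j\le i,\ \gamma\in T_j,\ \gamma'\in\mathcal E_i}\big(\mathrm{reg}^{\ell+i}(R)+\gamma-\gamma'\big)\supseteq \mathrm{reg}^\ell(R)+\bigcap_{0\le j\le i,\ \gamma\in T_j,\ \gamma'\in\mathcal E_i}(\gamma-\gamma'+\mathcal C),$$ and the same two inclusions hold when all the intersections are restricted to the indices $i$ with $\ell+i\le \mathrm{cd}_B(R)$. (2) If $S$ is a field, then $$\mathrm{reg}^\ell(M)\supseteq\bigcap_{i\ge 0,\ \gamma\in T_i,\ \gamma'\in\mathcal E_i}\big(\mathrm{reg}^{\ell+i}(R)+\gamma-\gamma'\big)\supseteq \mathrm{reg}^\ell(R)+\bigcap_{i\ge 0,\ \gamma\in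 T_i,\ \gamma'\in\mathcal E_i}(\gamma-\gamma'+\mathcal C).$$ (3) If $G=\mathbb Z$ and $\gamma_k=1$ for all $k$, then, with the usual numbers $r^\ell(N)=\sup\{\mu+i: i\ge\ell,\ H^i_B(N)_\mu\ne0\}\in[-\infty,\infty]$ and with $-\infty+\infty=-\infty$, $$r^\ell(M)\le r^\ell(R)+\sup\{\gamma-i:\ i\ge 0,\ \gamma\in T_i\}.$$ -/

import Mathlib

open scoped TensorProduct Pointwise

noncomputable section

namespace MultigradedReg

/-! ### Graded pieces and supports -/

/-- The support of a family of graded pieces: the degrees `γ` with nonzero piece. -/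
def gradedSupport {G N : Type*} [AddCommGroup N] (𝒩 : G → AddSubgroup N) : Set G :=
  {γ | 𝒩 γ ≠ ⊥}

/-- The homology module `Z / (Bd ∩ Z)` of cycles `Z` modulo boundaries `Bd` in a module `N`. -/
abbrev HomologyOf {R N : Type*} [CommRing R] [AddCommGroup N] [Module R N]
    (Z Bd : Submodule R N) : Type _ :=
  Z ⧸ Bd.submoduleOf Z

/-- The grading of the homology `Z / Bd` induced by a grading of `N`: the piece of degree `γ`
consists of the classes of the cycles of degree `γ`. -/
def homologyPiece {G R N : Type*} [CommRing R] [AddCommGroup N] [Module R N]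
    (Z Bd : Submodule R N) (𝒩 : G → AddSubgroup N) (γ : G) : AddSubgroup (HomologyOf Z Bd) :=
  ((𝒩 γ).comap Z.subtype.toAddMonoidHom).map (Bd.submoduleOf Z).mkQ.toAddMonoidHom

/-! ### The Čech complex and graded local cohomology -/

section Cech

variable {R : Type*} [CommRing R] {r : ℕ} (f : Fin r → R) (M : Type*) [AddCommGroup M] [Module R M]

/-- The localization of `M` at the product `f_I` of the `f j`, `j ∈ I`. -/
abbrev CechLoc (I : Finset (Fin r)) : Type _ :=
  LocalizedModule (Submonoid.powers (∏ j ∈ I, f j)) M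

theorem isUnit_of_subset {I J : Finset (Fin r)} (h : I ⊆ J)
    (x : Submonoid.powers (∏ j ∈ I, f j)) :
    IsUnit (algebraMap R (Module.End R (CechLoc f M J)) x) := by
  obtain ⟨y, hy⟩ := x
  obtain ⟨k, rfl⟩ := hy
  have hJ : IsUnit (algebraMap R (Module.End R (CechLoc f M J)) (∏ j ∈ J, f j)) :=
    (localizedModuleIsLocalizedModule (Submonoid.powers (∏ j ∈ J, f j)) (M := M)).map_units
      ⟨_, Submonoid.mem_powers _⟩
  obtain ⟨c, hc⟩ := Finset.prod_dvd_prod_of_subset I J f h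
  have hc' : algebraMap R (Module.End R (CechLoc f M J)) (∏ j ∈ J, f j) =
      algebraMap R _ (∏ j ∈ I, f j) * algebraMap R _ c :=
    (congrArg _ hc).trans (map_mul _ _ _)
  rw [hc', Commute.isUnit_mul_iff (Algebra.commutes _ _)] at hJ
  simpa only [map_pow] using hJ.1.pow k

/-- The canonical map `M_{f_I} → M_{f_J}` for `I ⊆ J`. -/
def cechRestrict {I J : Finset (Fin r)} (h : I ⊆ J) : CechLoc f M I →ₗ[R] CechLoc f M J :=
  LocalizedModule.lift _ (LocalizedModule.mkLinearMap (Submonoid.powers (∏ j ∈ J, f j)) M)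
    (isUnit_of_subset f M h)

/-- Čech cochains of degree `p`: the product of the `M_{f_I}` over the `I` with `p` elements.
In degree `0` this is `M` itself (localized at `1`). -/
abbrev CechCochain (p : ℕ) : Type _ :=
  (I : {I : Finset (Fin r) // I.card = p}) → CechLoc f M I.1

/-- The Čech differential
`(d x)_J = ∑_{j ∈ J} (-1) ^ #{k ∈ J | k < j} x_{J \ {j}}`. -/
def cechD (p : ℕ) : CechCochain f M p →ₗ[R] CechCochain f M (p + 1) :=
  LinearMap.pi fun J => ∑ j : {j // j ∈ J.1},
    ((-1 : ℤ) ^ (J.1.filter (· < j.1)).card) •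
      (cechRestrict f M (Finset.erase_subset j.1 J.1) ∘ₗ
        LinearMap.proj (⟨J.1.erase j.1, by
          rw [Finset.card_erase_of_mem j.2, J.2, Nat.add_sub_cancel]⟩ :
            {I : Finset (Fin r) // I.card = p}))

/-- The coboundaries of the Čech complex. -/
def cechBoundary : (p : ℕ) → Submodule R (CechCochain f M p)
  | 0 => ⊥
  | p + 1 => LinearMap.range (cechD f M p)

/-- The local cohomology module `H^p_B(M)`, `B` the ideal generated by the `f j`, as the
cohomology of the Čech complex of `f`. -/
abbrev LocalCohomology (p : ℕ) : Type _ :=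
  HomologyOf (LinearMap.ker (cechD f M p)) (cechBoundary f M p)

/-- The cohomological dimension `cd_B(M)`, the largest `p` with `H^p_B(M) ≠ 0`
(`-∞` if there is none). -/
def cohomDim : EReal :=
  ⨆ (p : ℕ) (_ : Nontrivial (LocalCohomology f M p)), ((p : ℝ) : EReal)

variable {M} {G : Type*} [AddCommGroup G] (δ : Fin r → G) (ℳ : G → AddSubgroup M)

/-- The grading of `M_{f_I}`, where `f j` has degree `δ j`: the fraction `m / f_I ^ k` has degree
`deg m - k • deg f_I`. -/
def cechLocPiece (I : Finset (Fin r)) (γ : G) : AddSubgroup (CechLoc f M I) :=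
  AddSubgroup.closure {y | ∃ (k : ℕ) (m : M), m ∈ ℳ (γ + k • ∑ j ∈ I, δ j) ∧
    y = LocalizedModule.mk m ⟨(∏ j ∈ I, f j) ^ k, pow_mem (Submonoid.mem_powers _) k⟩}

/-- The grading of the Čech cochains. -/
def cechPiece (p : ℕ) (γ : G) : AddSubgroup (CechCochain f M p) :=
  AddSubgroup.pi Set.univ fun I => cechLocPiece f δ ℳ I.1 γ

/-- The set of degrees `γ` with `H^p_B(M)_γ ≠ 0`. -/
def localCohomologySupport (p : ℕ) : Set G :=
  gradedSupport (homologyPiece (LinearMap.ker (cechD f M p)) (cechBoundary f M p)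
    (cechPiece f δ ℳ p))

end Cech

/-! ### Graded polynomial rings, regularity -/

section Poly

variable {S G : Type*} [CommRing S] [AddCommGroup G] {n : ℕ} (deg : Fin n → G)

/-- The ideal `(X_1, …, X_n)`. -/
def irrelevant (S : Type*) [CommRing S] (n : ℕ) : Ideal (MvPolynomial (Fin n) S) :=
  Ideal.span (Set.range MvPolynomial.X)

/-- The grading of `S[X_1, …, X_n]` with `deg X_i = deg i` and `S` in degree `0`. -/
def polyPiece (S : Type*) [CommRing S] (γ : G) : AddSubgroup (MvPolynomial (Fin n) S) :=
  (MvPolynomial.weightedHomogeneousSubmodule S deg γ).toAddSubgroup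

/-- `𝓔_l`: the sums of the degrees of `l` distinct variables. -/
def degSums (l : ℕ) : Set G :=
  {γ | ∃ s : Finset (Fin n), s.card = l ∧ γ = ∑ i ∈ s, deg i}

/-- `𝓒`: the submonoid generated by the degrees of the variables. -/
def degMonoid : AddSubmonoid G :=
  AddSubmonoid.closure (Set.range deg)

/-- `reg^ℓ(M)`, with respect to the ideal `B` generated by the `f j` (of degree `δ j`). -/
def reg {r : ℕ} (f : Fin r → MvPolynomial (Fin n) S) (δ : Fin r → G)
    {M : Type*} [AddCommGroup M] [Module (MvPolynomial (Fin n) S) M] (ℳ : G → AddSubgroup M)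
    (ℓ : ℤ) : Set G :=
  {γ | ∀ c ∈ degMonoid deg,
    γ + c ∉ ⋃ (i : ℕ) (_ : ℓ ≤ i), localCohomologySupport f δ ℳ i + degSums deg i}

/-- The grading of the free module `⨁_k R[-e k]` over `R = S[X_1, …, X_n]`, where
`R[-γ]_μ = R_{μ - γ}`. -/
def freePiece {ι : Type*} (e : ι → G) (γ : G) : AddSubgroup (ι →₀ MvPolynomial (Fin n) S) where
  carrier := {x | ∀ k, x k ∈ polyPiece deg S (γ - e k)}
  zero_mem' _ := zero_mem _
  add_mem' hx hy k := add_mem (hx k) (hy k)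
  neg_mem' hx k := neg_mem (hx k)

universe w

/-- A graded free resolution `⋯ → F_1 → F_0 → M → 0` of a graded module `M` over
`R = S[X_1, …, X_n]`, where `F_i = ⨁_k R[-shift i k]`. -/
structure GradedFreeResolution {M : Type*} [AddCommGroup M] [Module (MvPolynomial (Fin n) S) M]
    (ℳ : G → AddSubgroup M) where
  ι : ℕ → Type w
  shift : ∀ i, ι i → G
  d : ∀ i, (ι (i + 1) →₀ MvPolynomial (Fin n) S) →ₗ[MvPolynomial (Fin n) S]
    (ι i →₀ MvPolynomial (Fin n) S)
  ε : (ι 0 →₀ MvPolynomial (Fin n) S) →ₗ[MvPolynomial (Fin n) S] M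
  d_mem : ∀ i γ, ∀ x ∈ freePiece deg (shift (i + 1)) γ, d i x ∈ freePiece deg (shift i) γ
  ε_mem : ∀ γ, ∀ x ∈ freePiece deg (shift 0) γ, ε x ∈ ℳ γ
  ε_surjective : Function.Surjective ε
  exact_zero : Function.Exact (d 0) ε
  exact_succ : ∀ i, Function.Exact (d (i + 1)) (d i)

namespace GradedFreeResolution

variable {deg} {M : Type*} [AddCommGroup M] [Module (MvPolynomial (Fin n) S) M]
  {ℳ : G → AddSubgroup M} (F : GradedFreeResolution.{w} (S := S) deg ℳ)

/-- The term `F_i ⊗_R S`, where `S = R / (X_1, …, X_n)`. -/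
abbrev tensorTerm (i : ℕ) : Type _ :=
  (F.ι i →₀ MvPolynomial (Fin n) S) ⊗[MvPolynomial (Fin n) S]
    (MvPolynomial (Fin n) S ⧸ irrelevant S n)

/-- The differential of `F ⊗_R S`. -/
def tensorD (i : ℕ) :
    F.tensorTerm (i + 1) →ₗ[MvPolynomial (Fin n) S] F.tensorTerm i :=
  (F.d i).rTensor (MvPolynomial (Fin n) S ⧸ irrelevant S n)

/-- The grading of `F_i ⊗_R S`. As `S = R / (X_1, …, X_n)` is generated by `1` and sits in
degree `0`, the piece of degree `γ` is the image of `(F_i)_γ`. -/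
def tensorPiece (i : ℕ) (γ : G) : AddSubgroup (F.tensorTerm i) :=
  (freePiece deg (F.shift i) γ).map
    ((TensorProduct.mk (MvPolynomial (Fin n) S) (F.ι i →₀ MvPolynomial (Fin n) S)
      (MvPolynomial (Fin n) S ⧸ irrelevant S n)).flip 1).toAddMonoidHom

/-- The cycles of `F ⊗_R S`. -/
def tensorCycle : (i : ℕ) → Submodule (MvPolynomial (Fin n) S) (F.tensorTerm i)
  | 0 => ⊤
  | i + 1 => LinearMap.ker (F.tensorD i)

/-- `Supp_G(Tor_i^R(M, S))`, with `Tor_i^R(M, S) = H_i(F ⊗_R S)`. -/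
def torSupport (i : ℕ) : Set G :=
  gradedSupport (homologyPiece (F.tensorCycle i) (LinearMap.range (F.tensorD i)) (F.tensorPiece i))

end GradedFreeResolution

/-- For a `ℤ`-grading with all variables of degree `1`, given through `φ : G ≃+ ℤ`, the usual
`reg^ℓ(M) = sup {μ + i | i ≥ ℓ, H^i_B(M)_μ ≠ 0}` in `[-∞, ∞]`. -/
def classicalReg (φ : G ≃+ ℤ) {r : ℕ} (f : Fin r → MvPolynomial (Fin n) S) (δ : Fin r → G)
    {M : Type*} [AddCommGroup M] [Module (MvPolynomial (Fin n) S) M] (ℳ : G → AddSubgroup M)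
    (ℓ : ℤ) : EReal :=
  ⨆ (i : ℕ) (_ : ℓ ≤ i) (μ ∈ localCohomologySupport f δ ℳ i), (((φ μ + i : ℤ) : ℝ) : EReal)

end Poly

end MultigradedReg

end

/-! Everything rests on one degree shift: if $H^i_B(M)_\mu\ne 0$, then $H^{i+q}_B(R)_{\mu-\tau}\ne
0$ for some $q\ge 0$ and $\tau\in A_q$, where $A_q=\bigcup_{j\le q}T_j$, or $A_q=T_q$ if $S$ is a
field. Its contrapositive is `GradedFreeResolution.cechAcyclic_of_poly`. What remains is bookkeeping
with supports (`mem_reg_of_shift`, `add_mem_reg_add_singleton`, `classicalReg_le_of_shift`). There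
$\mathrm{cd}_B(R)\le n$ leaves room to enlarge a set of $i$ variables by $q$ others; over a field
this bound is Grothendieck vanishing.

For the shift, choose as few homogeneous elements as possible that generate $M$ modulo $(X)M$; their
degrees lie in $A_0$. They need not generate $M$, since $(X)$ may have elements of degree $0$. But
graded Nakayama gives $u\in 1+(X)$ of degree $0$ such that $uM$ lies in the submodule $M'$ they
generate. The hypothesis on monomials of degree $0$ puts $u-1$ in $\sqrt B$. Local cohomology
classes are $B$-torsion, so $u$ acts injectively on them, and vanishing passes from $M'$ to $M$.
With $Z$ the kernel of the free cover $P\to M'$, the long exact sequence reduces $H^i(M')_\gamma=0$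
to $H^i(P)_\gamma=0$ and $H^{i+1}(Z)_\gamma=0$. The process is repeated with $Z$ and stops because
the Čech complex has length $r$ (`exists_syzygy_step`, `GradedFreeResolution.cechAcyclic_syzygy`).

The degrees of the generators of $Z$ are controlled as follows. An element of $Z$ whose degree is
not that of a generator of $P$ has coordinates of nonzero degree, so it lies in $(X)P$; and $Z\cap
(X)P=(X)Z$ in the degrees where $\mathrm{Tor}_1$ vanishes. This is why $A_q$ must increase with $q$.
Over a field, minimality alone gives $Z\subseteq (X)P$, and no union is needed.

The sets $T_i$ come from a given resolution, of which $Z$ is not a syzygy. The comparison is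
`StableRetract`: $Z$ is a summand of the corresponding syzygy up to multiplication by an element of
$(X)$ and up to maps through free modules. This relation passes to syzygies, and it transports the
vanishing of $\mathrm{Tor}_1$ (`StableRetract.exists_syzygy`). -/

noncomputable section

namespace MultigradedReg

/-! ### The Čech complex: calculus of fractions, functoriality, `d ∘ d = 0`. -/

section CechFunctor

variable {R : Type*} [CommRing R] {r : ℕ} (f : Fin r → R)
variable {M N : Type*} [AddCommGroup M] [Module R M] [AddCommGroup N] [Module R N]

/-- The fraction `m / f_I ^ k`. -/
def cechFrac (I : Finset (Fin r)) (m : M) (k : ℕ) : CechLoc f M I :=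
  LocalizedModule.mk m ⟨(∏ j ∈ I, f j) ^ k, pow_mem (Submonoid.mem_powers _) k⟩

theorem exists_cechFrac {I : Finset (Fin r)} (y : CechLoc f M I) :
    ∃ m k, y = cechFrac f I m k := by
  induction y using LocalizedModule.induction_on with
  | h m s =>
    obtain ⟨s, k, rfl⟩ := s
    exact ⟨m, k, rfl⟩

theorem cechFrac_eq_iff {I : Finset (Fin r)} {m m' : M} {k k' : ℕ} :
    cechFrac f I m k = cechFrac f I m' k' ↔
      ∃ l, (∏ j ∈ I, f j) ^ (l + k') • m = (∏ j ∈ I, f j) ^ (l + k) • m' := by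
  rw [cechFrac, cechFrac, LocalizedModule.mk_eq]
  constructor
  · rintro ⟨⟨u, l, rfl⟩, h⟩
    refine ⟨l, ?_⟩
    simpa [Submonoid.smul_def, smul_smul, pow_add] using h
  · rintro ⟨l, h⟩
    refine ⟨⟨_, l, rfl⟩, ?_⟩
    simpa [Submonoid.smul_def, smul_smul, pow_add] using h

theorem cechFrac_smul_pow {I : Finset (Fin r)} (m : M) (k l : ℕ) :
    cechFrac f I ((∏ j ∈ I, f j) ^ l • m) (k + l) = cechFrac f I m k := by
  rw [cechFrac_eq_iff]
  exact ⟨0, by rw [smul_smul]; congr 1; ring⟩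

theorem cechFrac_eq_zero_iff {I : Finset (Fin r)} {m : M} {k : ℕ} :
    cechFrac f I m k = 0 ↔ ∃ l, (∏ j ∈ I, f j) ^ l • m = 0 := by
  have h0 : (0 : CechLoc f M I) = cechFrac f I 0 0 := (LocalizedModule.zero_mk _).symm
  rw [h0, cechFrac_eq_iff]
  simp

@[simp]
theorem cechFrac_zero (I : Finset (Fin r)) (k : ℕ) : cechFrac f I (0 : M) k = 0 :=
  LocalizedModule.zero_mk _

theorem cechFrac_add (I : Finset (Fin r)) (m m' : M) (k : ℕ) :
    cechFrac f I (m + m') k = cechFrac f I m k + cechFrac f I m' k := by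
  rw [cechFrac, cechFrac, cechFrac, LocalizedModule.mk_add_mk, LocalizedModule.mk_eq]
  refine ⟨1, ?_⟩
  simp [Submonoid.smul_def, smul_smul]

theorem cechFrac_neg (I : Finset (Fin r)) (m : M) (k : ℕ) :
    cechFrac f I (-m) k = -cechFrac f I m k := by
  rw [eq_neg_iff_add_eq_zero, ← cechFrac_add, neg_add_cancel, cechFrac_zero]

theorem smul_cechFrac (I : Finset (Fin r)) (a : R) (m : M) (k : ℕ) :
    a • cechFrac f I m k = cechFrac f I (a • m) k := by
  rw [cechFrac, LocalizedModule.smul'_mk]; rfl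

theorem cechRestrict_cechFrac {I J : Finset (Fin r)} (h : I ⊆ J) (m : M) (k : ℕ) :
    cechRestrict f M h (cechFrac f I m k) = cechFrac f J ((∏ j ∈ J \ I, f j) ^ k • m) k := by
  rw [cechRestrict, cechFrac, LocalizedModule.lift_mk]
  rw [Module.End.algebraMap_isUnit_inv_apply_eq_iff]
  rw [LocalizedModule.mkLinearMap_apply]
  have h1 : (1 : Submonoid.powers (∏ j ∈ J, f j)) =
      ⟨(∏ j ∈ J, f j) ^ 0, pow_mem (Submonoid.mem_powers _) 0⟩ := Subtype.ext (pow_zero _).symm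
  rw [h1]
  change cechFrac f J m 0 = (∏ j ∈ I, f j) ^ k • cechFrac f J ((∏ j ∈ J \ I, f j) ^ k • m) k
  rw [smul_cechFrac, smul_smul, ← mul_pow, mul_comm, Finset.prod_sdiff h]
  simpa using (cechFrac_smul_pow f (I := J) m 0 k).symm

theorem cechRestrict_trans {I J K : Finset (Fin r)} (h : I ⊆ J) (h' : J ⊆ K) (y : CechLoc f M I) :
    cechRestrict f M h' (cechRestrict f M h y) = cechRestrict f M (h.trans h') y := by
  obtain ⟨m, k, rfl⟩ := exists_cechFrac f y
  simp only [cechRestrict_cechFrac, smul_smul, ← mul_pow]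
  congr 3
  rw [← Finset.prod_union]
  · congr 1
    ext x; simp only [Finset.mem_union, Finset.mem_sdiff]
    have := @h x; have := @h' x; tauto
  · rw [Finset.disjoint_left]; intro x; simp only [Finset.mem_sdiff]; tauto

/-- The map `M_{f_I} → N_{f_I}` induced by `φ : M → N`. -/
def cechLocMap (φ : M →ₗ[R] N) (I : Finset (Fin r)) : CechLoc f M I →ₗ[R] CechLoc f N I :=
  (LocalizedModule.map _ φ).restrictScalars R

theorem cechLocMap_cechFrac (φ : M →ₗ[R] N) (I : Finset (Fin r)) (m : M) (k : ℕ) :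
    cechLocMap f φ I (cechFrac f I m k) = cechFrac f I (φ m) k := by
  rw [cechLocMap, cechFrac, LinearMap.restrictScalars_apply, LocalizedModule.map_mk]; rfl

theorem cechLocMap_restrict (φ : M →ₗ[R] N) {I J : Finset (Fin r)} (h : I ⊆ J)
    (y : CechLoc f M I) :
    cechLocMap f φ J (cechRestrict f M h y) = cechRestrict f N h (cechLocMap f φ I y) := by
  obtain ⟨m, k, rfl⟩ := exists_cechFrac f y
  simp only [cechRestrict_cechFrac, cechLocMap_cechFrac, map_smul]

/-- The map of Čech cochains induced by `φ : M → N`. -/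
def cechMap (φ : M →ₗ[R] N) (p : ℕ) : CechCochain f M p →ₗ[R] CechCochain f N p :=
  LinearMap.pi fun I => cechLocMap f φ I.1 ∘ₗ LinearMap.proj I

@[simp]
theorem cechMap_apply (φ : M →ₗ[R] N) (p : ℕ) (x : CechCochain f M p)
    (I : {I : Finset (Fin r) // I.card = p}) :
    cechMap f φ p x I = cechLocMap f φ I.1 (x I) := rfl

/-- The component of a cochain at `I`, extended by zero to all index sets. -/
def cechComp {p : ℕ} (x : CechCochain f M p) (I : Finset (Fin r)) : CechLoc f M I :=
  if h : I.card = p then x ⟨I, h⟩ else 0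

theorem cechComp_coe {p : ℕ} (x : CechCochain f M p) (I : {I : Finset (Fin r) // I.card = p}) :
    cechComp f x I.1 = x I := dif_pos I.2

theorem cechD_apply (p : ℕ) (x : CechCochain f M p)
    (J : {I : Finset (Fin r) // I.card = p + 1}) :
    cechD f M p x J = ∑ j ∈ J.1, ((-1 : R) ^ (J.1.filter (· < j)).card) •
      cechRestrict f M (Finset.erase_subset j J.1) (cechComp f x (J.1.erase j)) := by
  rw [← Finset.sum_coe_sort, cechD, LinearMap.pi_apply, LinearMap.sum_apply]
  refine Finset.sum_congr rfl fun j _ => ?_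
  have h : ((-1 : R) ^ (J.1.filter (· < j.1)).card) =
      (((-1 : ℤ) ^ (J.1.filter (· < j.1)).card : ℤ) : R) := by push_cast; rfl
  have hc : (J.1.erase j.1).card = p := by
    rw [Finset.card_erase_of_mem j.2, J.2, Nat.add_sub_cancel]
  rw [h, Int.cast_smul_eq_zsmul, cechComp, dif_pos hc]
  rfl

theorem cechMap_cechD (φ : M →ₗ[R] N) (p : ℕ) (x : CechCochain f M p) :
    cechMap f φ (p + 1) (cechD f M p x) = cechD f N p (cechMap f φ p x) := by
  ext J
  rw [cechMap_apply, cechD_apply, cechD_apply, map_sum]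
  refine Finset.sum_congr rfl fun j _ => ?_
  rw [map_smul, cechLocMap_restrict]
  congr 2
  unfold cechComp
  split_ifs
  · rfl
  · simp

/-- Removing `i` lowers by one the number of elements below `j`, while removing `j` does not change
the number below `i`; so the two signs are opposite. -/
theorem sign_erase_add (R : Type*) [CommRing R] {r : ℕ}
    {K : Finset (Fin r)} {i j : Fin r} (hi : i ∈ K) (h : i < j) :
    (-1 : R) ^ (K.filter (· < j)).card * (-1) ^ ((K.erase j).filter (· < i)).card +
    (-1 : R) ^ (K.filter (· < i)).card * (-1) ^ ((K.erase i).filter (· < j)).card = 0 := by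
  have h1 : (K.erase j).filter (· < i) = K.filter (· < i) := by
    ext x; simp only [Finset.mem_filter, Finset.mem_erase]
    constructor
    · tauto
    · rintro ⟨a, b⟩; exact ⟨⟨(b.trans h).ne, a⟩, b⟩
  have h2 : ((K.erase i).filter (· < j)).card + 1 = (K.filter (· < j)).card := by
    rw [show (K.erase i).filter (· < j) = (K.filter (· < j)).erase i by grind]
    exact Finset.card_erase_add_one (by simp [hi, h])
  rw [h1, ← h2]; ring

theorem cechD_cechD (p : ℕ) (x : CechCochain f M p) : cechD f M (p + 1) (cechD f M p x) = 0 := by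
  ext K
  rw [cechD_apply, Pi.zero_apply]
  let t : Fin r → Fin r → CechLoc f M K.1 := fun j i =>
    ((-1 : R) ^ (K.1.filter (· < j)).card * (-1) ^ ((K.1.erase j).filter (· < i)).card) •
      cechRestrict f M ((Finset.erase_subset i _).trans (Finset.erase_subset j K.1))
        (cechComp f x ((K.1.erase j).erase i))
  have h1 : ∀ j ∈ K.1, ((-1 : R) ^ (K.1.filter (· < j)).card) •
      cechRestrict f M (Finset.erase_subset j K.1) (cechComp f (cechD f M p x) (K.1.erase j)) =
      ∑ i ∈ K.1.erase j, t j i := by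
    intro j hj
    have hc : (K.1.erase j).card = p + 1 := by
      rw [Finset.card_erase_of_mem hj, K.2, Nat.add_sub_cancel]
    rw [cechComp, dif_pos hc, cechD_apply, map_sum, Finset.smul_sum]
    refine Finset.sum_congr rfl fun i hi => ?_
    rw [map_smul, cechRestrict_trans, smul_smul]
  rw [Finset.sum_congr rfl h1]
  have ht : ∀ i ∈ K.1, ∀ j ∈ K.1, i < j → t j i + t i j = 0 := by
    intro i hi j hj hij
    have he : ∀ (A B : Finset (Fin r)) (hA : A ⊆ K.1) (hB : B ⊆ K.1), A = B →
        cechRestrict f M hA (cechComp f x A) = cechRestrict f M hB (cechComp f x B) := by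
      rintro A B hA hB rfl; rfl
    simp only [t]
    rw [he ((K.1.erase i).erase j) ((K.1.erase j).erase i)
      ((Finset.erase_subset j _).trans (Finset.erase_subset i K.1))
      ((Finset.erase_subset i _).trans (Finset.erase_subset j K.1)) (Finset.erase_right_comm),
      ← add_smul, sign_erase_add R hi hij, zero_smul]
  rw [Finset.sum_sigma']
  -- The term at `(j, i)` removes `j`, then `i`. Swapping the two is an involution without fixed
  -- points, and paired terms cancel.
  refine Finset.sum_involution (fun a _ => ⟨a.2, a.1⟩) ?_ ?_ ?_ ?_
  · rintro ⟨j, i⟩ h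
    simp only [Finset.mem_sigma, Finset.mem_erase] at h
    rcases lt_or_gt_of_ne h.2.1 with h' | h'
    · exact ht i h.2.2 j h.1 h'
    · exact (add_comm _ _).trans (ht j h.1 i h.2.2 h')
  · rintro ⟨j, i⟩ h _ he
    simp only [Finset.mem_sigma, Finset.mem_erase] at h
    simp only [Sigma.mk.injEq] at he
    exact h.2.1 he.1
  · rintro ⟨j, i⟩ h
    simp only [Finset.mem_sigma, Finset.mem_erase] at h ⊢
    exact ⟨h.2.2, h.2.1.symm, h.1⟩
  · rintro ⟨j, i⟩ h; rfl

theorem cechD_of_mem_cechBoundary {p : ℕ} {x : CechCochain f M p} (hx : x ∈ cechBoundary f M p) :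
    cechD f M p x = 0 := by
  cases p with
  | zero => rw [show x = 0 from hx, map_zero]
  | succ p =>
    obtain ⟨y, rfl⟩ := hx
    exact cechD_cechD f p y

theorem cechMap_mem_cechBoundary (φ : M →ₗ[R] N) {p : ℕ} {x : CechCochain f M p}
    (hx : x ∈ cechBoundary f M p) : cechMap f φ p x ∈ cechBoundary f N p := by
  cases p with
  | zero => rw [show x = 0 from hx, map_zero]; exact zero_mem _
  | succ p =>
    obtain ⟨y, rfl⟩ := hx
    exact ⟨cechMap f φ p y, (cechMap_cechD f φ p y).symm⟩

theorem cechMap_comp {L : Type*} [AddCommGroup L] [Module R L] (ψ : N →ₗ[R] L) (φ : M →ₗ[R] N)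
    (p : ℕ) (x : CechCochain f M p) :
    cechMap f ψ p (cechMap f φ p x) = cechMap f (ψ ∘ₗ φ) p x := by
  ext I
  simp only [cechMap_apply]
  obtain ⟨m, k, h⟩ := exists_cechFrac f (x I)
  simp only [h, cechLocMap_cechFrac, LinearMap.comp_apply]

theorem cechMap_smul_id (a : R) (p : ℕ) (x : CechCochain f M p) :
    cechMap f (a • LinearMap.id) p x = a • x := by
  ext I
  simp only [cechMap_apply, Pi.smul_apply]
  obtain ⟨m, k, h⟩ := exists_cechFrac f (x I)
  simp only [h, cechLocMap_cechFrac, smul_cechFrac, LinearMap.smul_apply, LinearMap.id_apply]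

theorem cechMap_id (p : ℕ) (x : CechCochain f M p) : cechMap f LinearMap.id p x = x := by
  simpa using cechMap_smul_id f (1 : R) p x

theorem cechMap_zero (p : ℕ) (x : CechCochain f M p) :
    cechMap f (0 : M →ₗ[R] N) p x = 0 := by
  ext I
  simp only [cechMap_apply, Pi.zero_apply]
  obtain ⟨m, k, h⟩ := exists_cechFrac f (x I)
  simp [h, cechLocMap_cechFrac]

theorem cechMap_sum {ι : Type*} (s : Finset ι) (φ : ι → M →ₗ[R] N) (p : ℕ)
    (x : CechCochain f M p) :
    cechMap f (∑ i ∈ s, φ i) p x = ∑ i ∈ s, cechMap f (φ i) p x := by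
  classical
  induction s using Finset.induction_on with
  | empty => simp [cechMap_zero]
  | insert a s ha ih =>
    rw [Finset.sum_insert ha, Finset.sum_insert ha, ← ih]
    ext I
    simp only [cechMap_apply, Pi.add_apply]
    obtain ⟨m, k, h⟩ := exists_cechFrac f (x I)
    simp only [h, cechLocMap_cechFrac, LinearMap.add_apply, cechFrac_add]

end CechFunctor

/-! ### Vanishing of a graded piece of homology in terms of cycles and boundaries. -/

section Homology

theorem notMem_gradedSupport_homologyPiece_iff {G R N : Type*} [CommRing R] [AddCommGroup N]
    [Module R N] (Z Bd : Submodule R N) (𝒩 : G → AddSubgroup N) (γ : G) :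
    γ ∉ gradedSupport (homologyPiece Z Bd 𝒩) ↔ ∀ x ∈ Z, x ∈ 𝒩 γ → x ∈ Bd := by
  simp only [gradedSupport, homologyPiece, Set.mem_ofPred_eq, not_not, AddSubgroup.map_eq_bot_iff]
  constructor
  · intro h x hxZ hx
    have := @h ⟨x, hxZ⟩ hx
    exact (Submodule.Quotient.mk_eq_zero (Bd.submoduleOf Z)).1 this
  · rintro h ⟨x, hxZ⟩ hx
    exact (Submodule.Quotient.mk_eq_zero (Bd.submoduleOf Z)).2 (h x hxZ hx)

end Homology

/-! ### Local cohomology is torsion with respect to `B`. -/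

section CechTorsion

variable {R : Type*} [CommRing R] {r : ℕ} (f : Fin r → R)
variable {M : Type*} [AddCommGroup M] [Module R M]

theorem cechRestrict_cechComp_congr {p : ℕ} (x : CechCochain f M p) {A B K : Finset (Fin r)}
    (hA : A ⊆ K) (hB : B ⊆ K) (h : A = B) :
    cechRestrict f M hA (cechComp f x A) = cechRestrict f M hB (cechComp f x B) := by
  subst h; rfl

/-- If `x` vanishes at all index sets containing `j`, the differential of `x` at `J ∪ {j}` only
involves the component of `x` at `J`. -/
theorem cechD_insert {p : ℕ} {x : CechCochain f M p} {j : Fin r}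
    (hx : ∀ I, j ∈ I → cechComp f x I = 0) {J : Finset (Fin r)} (hj : j ∉ J) (hJ : J.card = p) :
    cechComp f (cechD f M p x) (insert j J) =
      ((-1 : R) ^ ((insert j J).filter (· < j)).card) •
        cechRestrict f M (Finset.subset_insert j J) (cechComp f x J) := by
  have hc : (insert j J).card = p + 1 := by rw [Finset.card_insert_of_notMem hj, hJ]
  rw [cechComp, dif_pos hc, cechD_apply, Finset.sum_eq_single j]
  · congr 1
    exact cechRestrict_cechComp_congr f x _ _ (Finset.erase_insert hj)
  · intro i _ hij
    rw [hx, map_zero, smul_zero]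
    simp [hij.symm]
  · intro h; exact absurd (Finset.mem_insert_self j J) h

/-- Adding `j` to the index set inverts `f j`, so a large power of `f j` clears the new denominator.
Allowing every larger exponent lets finitely many index sets share one. -/
theorem exists_cechRestrict_insert_eq {J : Finset (Fin r)} {j : Fin r} (hj : j ∉ J)
    (z : CechLoc f M (insert j J)) :
    ∃ k, ∀ l ≥ k, ∃ y : CechLoc f M J,
      cechRestrict f M (Finset.subset_insert j J) y = f j ^ l • z := by
  obtain ⟨m, k, rfl⟩ := exists_cechFrac f z
  refine ⟨k, fun l hl => ⟨f j ^ (l - k) • cechFrac f J m k, ?_⟩⟩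
  rw [map_smul, cechRestrict_cechFrac, Finset.insert_sdiff_cancel hj, Finset.prod_singleton,
    smul_cechFrac, smul_cechFrac, smul_smul, ← pow_add, Nat.sub_add_cancel hl]

theorem exists_pow_smul_eq_zero_of_cechRestrict {J : Finset (Fin r)} {j : Fin r} (hj : j ∉ J)
    (z : CechLoc f M J) (hz : cechRestrict f M (Finset.subset_insert j J) z = 0) :
    ∃ k, ∀ l ≥ k, f j ^ l • z = 0 := by
  obtain ⟨m, k, rfl⟩ := exists_cechFrac f z
  rw [cechRestrict_cechFrac, Finset.insert_sdiff_cancel hj, Finset.prod_singleton,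
    cechFrac_eq_zero_iff] at hz
  obtain ⟨s, hs⟩ := hz
  refine ⟨s + k, fun l hl => ?_⟩
  rw [smul_cechFrac, cechFrac_eq_zero_iff]
  refine ⟨s, ?_⟩
  rw [Finset.prod_insert hj, smul_smul] at hs
  obtain ⟨c, rfl⟩ := Nat.exists_eq_add_of_le hl
  rw [smul_smul, show (∏ j ∈ J, f j) ^ s * f j ^ (s + k + c) =
    f j ^ c * ((f j * ∏ j ∈ J, f j) ^ s * f j ^ k) by ring, mul_smul, hs, smul_zero]

theorem cechComp_sub {p : ℕ} (x y : CechCochain f M p) (I : Finset (Fin r)) :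
    cechComp f (x - y) I = cechComp f x I - cechComp f y I := by
  unfold cechComp; split_ifs <;> simp

theorem cechComp_smul {p : ℕ} (a : R) (x : CechCochain f M p) (I : Finset (Fin r)) :
    cechComp f (a • x) I = a • cechComp f x I := by
  unfold cechComp; split_ifs <;> simp

theorem exists_uniform_bound {α : Type*} [Finite α] {P : α → ℕ → Prop}
    (h : ∀ a, ∃ k, ∀ l ≥ k, P a l) : ∃ k, ∀ a, P a k := by
  have : ∀ᶠ k in Filter.atTop, ∀ a, P a k :=
    Filter.eventually_all.2 fun a => Filter.eventually_atTop.2 (h a)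
  exact this.exists

/-- The Čech complex is a cone of the localization at `f j` of the complex of the other generators.
A power of `f j` makes the components of `x` at the sets `insert j I` come from `M_{f_I}`; those
preimages form a cochain `y`, whose differential cancels them. -/
theorem exists_cechBoundary_sub_vanishing {p : ℕ} (x : CechCochain f M p) (j : Fin r) :
    ∃ k, ∃ b ∈ cechBoundary f M p, ∀ J, j ∈ J → cechComp f (f j ^ k • x - b) J = 0 := by
  cases p with
  | zero =>
    refine ⟨0, 0, zero_mem _, fun J hj => ?_⟩
    rw [cechComp, dif_neg]
    exact fun h => by simp [Finset.card_eq_zero.1 h] at hj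
  | succ q =>
    obtain ⟨k, hk⟩ := exists_uniform_bound (α := {I : Finset (Fin r) // j ∉ I})
      fun I => exists_cechRestrict_insert_eq f I.2
        (((-1 : R) ^ ((insert j I.1).filter (· < j)).card) • cechComp f x (insert j I.1))
    choose Y hY using hk
    let y : CechCochain f M q := fun I => if h : j ∈ I.1 then 0 else Y ⟨I.1, h⟩
    have hy0 : ∀ I, j ∈ I → cechComp f y I = 0 := by
      intro I hI
      by_cases h : I.card = q <;> simp [cechComp, h, y, hI]
    refine ⟨k, cechD f M q y, ⟨y, rfl⟩, fun J hj => ?_⟩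
    obtain ⟨I, hI, rfl⟩ : ∃ I, j ∉ I ∧ J = insert j I :=
      ⟨J.erase j, by simp, (Finset.insert_erase hj).symm⟩
    by_cases hc : I.card = q
    · rw [cechComp_sub, cechD_insert f hy0 hI hc, cechComp_smul]
      have : cechComp f y I = Y ⟨I, hI⟩ := by simp [cechComp, hc, y, hI]
      have hYI : cechRestrict f M (Finset.subset_insert j I) (Y ⟨I, hI⟩) = f j ^ k •
        (((-1 : R) ^ ((insert j I).filter (· < j)).card) • cechComp f x (insert j I)) := hY ⟨I, hI⟩
      rw [this, hYI, smul_comm, smul_smul ((-1 : R) ^ _) ((-1 : R) ^ _), ← mul_pow]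
      simp
    · rw [cechComp, dif_neg]
      rw [Finset.card_insert_of_notMem hI]
      omega

/-- Local cohomology classes are torsion with respect to each of the `f j`. -/
theorem exists_pow_smul_mem_cechBoundary {p : ℕ} {x : CechCochain f M p}
    (hx : cechD f M p x = 0) (j : Fin r) : ∃ k, f j ^ k • x ∈ cechBoundary f M p := by
  obtain ⟨k, b, hb, hz⟩ := exists_cechBoundary_sub_vanishing f x j
  set z := f j ^ k • x - b with hzdef
  have hdz : cechD f M p z = 0 := by
    rw [hzdef, map_sub, map_smul, hx, smul_zero, cechD_of_mem_cechBoundary f hb, sub_zero]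
  obtain ⟨l, hl⟩ := exists_uniform_bound (α := {I : Finset (Fin r) // I.card = p})
    (P := fun I l => f j ^ l • z I = 0) (by
      intro I
      by_cases hj : j ∈ I.1
      · exact ⟨0, fun l _ => by rw [← cechComp_coe f z, hz _ hj, smul_zero]⟩
      -- As `z` vanishes at the sets containing `j`, the cocycle condition at `insert j I` has a
      -- single term: the restriction of `z I` is zero.
      · refine exists_pow_smul_eq_zero_of_cechRestrict f hj (z I) ?_
        have h := cechD_insert f hz hj I.2
        rw [hdz, cechComp_coe] at h
        have h0 : cechComp f (0 : CechCochain f M (p + 1)) (insert j I.1) = 0 := by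
          unfold cechComp; split_ifs <;> rfl
        rw [h0] at h
        have h2 := congrArg (((-1 : R) ^ ((insert j I.1).filter (· < j)).card) • ·) h
        simp only [smul_smul, ← mul_pow, smul_zero] at h2
        simpa using h2.symm)
  refine ⟨l + k, ?_⟩
  have hlz : f j ^ l • z = 0 := funext hl
  rw [hzdef, smul_sub, sub_eq_zero, smul_smul, ← pow_add] at hlz
  rw [hlz]
  exact Submodule.smul_mem _ _ hb

/-- An element of the radical of `(f_j)` acts nilpotently on every local cohomology class. -/
theorem exists_pow_smul_mem_cechBoundary_of_mem_radical {p : ℕ} {x : CechCochain f M p}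
    (hx : cechD f M p x = 0) {a : R} (ha : a ∈ (Ideal.span (Set.range f)).radical) :
    ∃ k, a ^ k • x ∈ cechBoundary f M p := by
  -- `A` is the annihilator of the class of `x`; each `f j` lies in its radical, hence so does the
  -- radical of `(f_j)`.
  let A : Ideal R := (cechBoundary f M p).comap (LinearMap.toSpanSingleton R _ x)
  have hA : ∀ b, b ∈ A ↔ b • x ∈ cechBoundary f M p := fun b => Iff.rfl
  have h : Ideal.span (Set.range f) ≤ A.radical := by
    rw [Ideal.span_le]
    rintro _ ⟨j, rfl⟩
    obtain ⟨k, hk⟩ := exists_pow_smul_mem_cechBoundary f hx j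
    exact ⟨k, hk⟩
  obtain ⟨k, hk⟩ := (Ideal.radical_le_radical_iff.2 h) ha
  exact ⟨k, hk⟩

/-- If `1 + m` kills a local cohomology class, with `m` in the radical of `(f_j)`, then the class
is zero. -/
theorem mem_cechBoundary_of_smul_mem {p : ℕ} {x : CechCochain f M p}
    (hx : cechD f M p x = 0) {u : R} (hu : u - 1 ∈ (Ideal.span (Set.range f)).radical)
    (hux : u • x ∈ cechBoundary f M p) : x ∈ cechBoundary f M p := by
  obtain ⟨k, hk⟩ := exists_pow_smul_mem_cechBoundary_of_mem_radical f hx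
    (a := 1 - u) (by simpa using neg_mem hu)
  -- Geometric series: `u` is invertible modulo the power of `1 - u` that kills the class.
  have hu' : u ∣ 1 - (1 - u) ^ k := by
    simpa using sub_dvd_pow_sub_pow (1 : R) (1 - u) k
  obtain ⟨c, hc⟩ := hu'
  have : x = c • u • x + (1 - u) ^ k • x := by
    rw [smul_smul, ← add_smul, mul_comm, ← hc, sub_add_cancel, one_smul]
  rw [this]
  exact add_mem (Submodule.smul_mem _ _ hux) hk

end CechTorsion

/-! ### The grading of the Čech complex. -/

section CechGrading

variable {R : Type*} [CommRing R] {r : ℕ} (f : Fin r → R)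
variable {G : Type*} [AddCommGroup G] (δ : Fin r → G)
variable {M : Type*} [AddCommGroup M] [Module R M]

/-- Every cycle of degree `γ` in the Čech complex is a boundary. -/
def CechAcyclic (ℳ : G → AddSubgroup M) (p : ℕ) (γ : G) : Prop :=
  ∀ x ∈ cechPiece f δ ℳ p γ, cechD f M p x = 0 → x ∈ cechBoundary f M p

/-- Multiplication by `f j` shifts degrees by `δ j`. -/
def CechCompatible (ℳ : G → AddSubgroup M) : Prop :=
  ∀ j γ, ∀ m ∈ ℳ γ, f j • m ∈ ℳ (γ + δ j)

/-- Projections to the graded pieces, compatible with multiplication by the `f j`. -/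
structure CechProjections (ℳ : G → AddSubgroup M) where
  proj : G → M →+ M
  proj_mem : ∀ γ m, proj γ m ∈ ℳ γ
  proj_of_mem : ∀ {γ m}, m ∈ ℳ γ → proj γ m = m
  proj_smul : ∀ j γ m, proj (γ + δ j) (f j • m) = f j • proj γ m

theorem notMem_localCohomologySupport_iff (ℳ : G → AddSubgroup M) (p : ℕ) (γ : G) :
    γ ∉ localCohomologySupport f δ ℳ p ↔ CechAcyclic f δ ℳ p γ := by
  rw [localCohomologySupport, notMem_gradedSupport_homologyPiece_iff]
  exact ⟨fun h x hx hdx => h x hdx hx, fun h x hdx hx => h x hx hdx⟩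

variable {f δ} {ℳ : G → AddSubgroup M}

theorem CechProjections.compatible (h : CechProjections f δ ℳ) : CechCompatible f δ ℳ := by
  intro j γ m hm
  rw [← h.proj_of_mem hm, ← h.proj_smul]
  exact h.proj_mem _ _

theorem CechCompatible.prod_smul_mem (h : CechCompatible f δ ℳ) (I : Finset (Fin r)) {γ : G}
    {m : M} (hm : m ∈ ℳ γ) : (∏ j ∈ I, f j) • m ∈ ℳ (γ + ∑ j ∈ I, δ j) := by
  induction I using Finset.induction_on with
  | empty => simpa using hm
  | insert j I hj ih =>
    rw [Finset.prod_insert hj, Finset.sum_insert hj, mul_smul, add_comm (δ j), ← add_assoc]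
    exact h j _ _ ih

theorem CechCompatible.pow_smul_mem (h : CechCompatible f δ ℳ) (I : Finset (Fin r)) {γ : G}
    {m : M} (hm : m ∈ ℳ γ) (k : ℕ) : (∏ j ∈ I, f j) ^ k • m ∈ ℳ (γ + k • ∑ j ∈ I, δ j) := by
  induction k with
  | zero => simpa using hm
  | succ k ih =>
    rw [pow_succ', mul_smul, succ_nsmul, ← add_assoc]
    exact h.prod_smul_mem I ih

theorem CechProjections.proj_prod_smul (h : CechProjections f δ ℳ) (I : Finset (Fin r)) (γ : G)
    (m : M) : h.proj (γ + ∑ j ∈ I, δ j) ((∏ j ∈ I, f j) • m) = (∏ j ∈ I, f j) • h.proj γ m := by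
  induction I using Finset.induction_on with
  | empty => simp
  | insert j I hj ih =>
    rw [Finset.prod_insert hj, Finset.sum_insert hj, mul_smul, add_comm (δ j), ← add_assoc,
      h.proj_smul, ih, mul_smul]

theorem CechProjections.proj_pow_smul (h : CechProjections f δ ℳ) (I : Finset (Fin r)) (γ : G)
    (m : M) (k : ℕ) : h.proj (γ + k • ∑ j ∈ I, δ j) ((∏ j ∈ I, f j) ^ k • m) =
      (∏ j ∈ I, f j) ^ k • h.proj γ m := by
  induction k with
  | zero => simp
  | succ k ih =>
    rw [pow_succ', mul_smul, succ_nsmul, ← add_assoc, h.proj_prod_smul, ih, mul_smul]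

theorem cechFrac_mem_cechLocPiece {I : Finset (Fin r)} {γ : G} {m : M} {k : ℕ}
    (hm : m ∈ ℳ (γ + k • ∑ j ∈ I, δ j)) : cechFrac f I m k ∈ cechLocPiece f δ ℳ I γ :=
  AddSubgroup.subset_closure ⟨k, m, hm, rfl⟩

/-- Homogeneous fractions of one degree can be put over a common power of `f_I`, so they already
form a subgroup. -/
theorem CechCompatible.exists_of_mem_cechLocPiece (h : CechCompatible f δ ℳ) {I : Finset (Fin r)}
    {γ : G} {y : CechLoc f M I} (hy : y ∈ cechLocPiece f δ ℳ I γ) :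
    ∃ k, ∃ m ∈ ℳ (γ + k • ∑ j ∈ I, δ j), y = cechFrac f I m k := by
  refine AddSubgroup.closure_induction (p := fun y _ =>
    ∃ k, ∃ m ∈ ℳ (γ + k • ∑ j ∈ I, δ j), y = cechFrac f I m k) ?_ ?_ ?_ ?_ hy
  · rintro y ⟨k, m, hm, rfl⟩
    exact ⟨k, m, hm, rfl⟩
  · exact ⟨0, 0, zero_mem _, (cechFrac_zero f I 0).symm⟩
  · rintro _ _ _ _ ⟨k, m, hm, rfl⟩ ⟨k', m', hm', rfl⟩
    refine ⟨k + k', (∏ j ∈ I, f j) ^ k' • m + (∏ j ∈ I, f j) ^ k • m', add_mem ?_ ?_, ?_⟩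
    · rw [add_smul, ← add_assoc]; exact h.pow_smul_mem I hm k'
    · rw [add_comm k, add_smul, ← add_assoc]; exact h.pow_smul_mem I hm' k
    · rw [cechFrac_add, cechFrac_smul_pow, add_comm k, cechFrac_smul_pow]
  · rintro _ _ ⟨k, m, hm, rfl⟩
    exact ⟨k, -m, neg_mem hm, (cechFrac_neg f I m k).symm⟩

theorem CechCompatible.cechRestrict_mem (h : CechCompatible f δ ℳ) {I J : Finset (Fin r)}
    (hIJ : I ⊆ J) {γ : G} {y : CechLoc f M I} (hy : y ∈ cechLocPiece f δ ℳ I γ) :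
    cechRestrict f M hIJ y ∈ cechLocPiece f δ ℳ J γ := by
  obtain ⟨k, m, hm, rfl⟩ := h.exists_of_mem_cechLocPiece hy
  rw [cechRestrict_cechFrac]
  refine cechFrac_mem_cechLocPiece ?_
  rw [← Finset.sum_sdiff hIJ, smul_add, add_comm (k • _), ← add_assoc]
  exact h.pow_smul_mem _ hm k

theorem mem_cechPiece {p : ℕ} {γ : G} {x : CechCochain f M p} :
    x ∈ cechPiece f δ ℳ p γ ↔ ∀ I, x I ∈ cechLocPiece f δ ℳ I.1 γ := by
  simp [cechPiece, AddSubgroup.mem_pi]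

theorem CechCompatible.cechD_mem (h : CechCompatible f δ ℳ) {p : ℕ} {γ : G}
    {x : CechCochain f M p} (hx : x ∈ cechPiece f δ ℳ p γ) :
    cechD f M p x ∈ cechPiece f δ ℳ (p + 1) γ := by
  rw [mem_cechPiece] at hx ⊢
  intro J
  rw [cechD_apply]
  refine sum_mem fun j _ => ?_
  have hc : cechComp f x (J.1.erase j) ∈ cechLocPiece f δ ℳ (J.1.erase j) γ := by
    unfold cechComp
    split_ifs with hI
    · exact hx ⟨_, hI⟩
    · exact zero_mem _
  have := h.cechRestrict_mem (Finset.erase_subset j J.1) hc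
  rcases neg_one_pow_eq_or R ((J.1.filter (· < j)).card) with h1 | h1 <;> rw [h1]
  · rwa [one_smul]
  · rw [neg_smul, one_smul]; exact neg_mem this

/-- The projection of `M_{f_I}` to its piece of degree `γ`. -/
def CechProjections.locProj (h : CechProjections f δ ℳ) (I : Finset (Fin r)) (γ : G) :
    CechLoc f M I → CechLoc f M I := fun y =>
  LocalizedModule.liftOn y
    -- The exponent of a denominator is a choice, since powers of `f_I` may coincide. Projecting an
    -- equation between numerators in a common degree makes the choice immaterial.
    (fun q => cechFrac f I (h.proj (γ + q.2.2.choose • ∑ j ∈ I, δ j) q.1) q.2.2.choose) (by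
      rintro ⟨m, s⟩ ⟨m', s'⟩ ⟨⟨_, l, rfl⟩, hu⟩
      have hs := s.2.choose_spec
      have hs' := s'.2.choose_spec
      simp only [Submonoid.smul_def] at hu
      rw [← hs, ← hs', smul_smul, smul_smul] at hu
      simp only [← pow_add] at hu
      rw [cechFrac_eq_iff]
      refine ⟨l, ?_⟩
      rw [← h.proj_pow_smul, ← h.proj_pow_smul, hu]
      congr 1
      congr 1
      simp only [add_smul]
      abel)

theorem CechProjections.locProj_cechFrac (h : CechProjections f δ ℳ) (I : Finset (Fin r)) (γ : G)
    (m : M) (k : ℕ) : h.locProj I γ (cechFrac f I m k) =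
      cechFrac f I (h.proj (γ + k • ∑ j ∈ I, δ j) m) k := by
  rw [CechProjections.locProj, cechFrac, LocalizedModule.liftOn_mk]
  generalize_proofs h1 h2
  have hs : (∏ j ∈ I, f j) ^ h1.choose = (∏ j ∈ I, f j) ^ k := h1.choose_spec
  generalize h1.choose = l at hs ⊢
  change cechFrac f I _ l = cechFrac f I _ k
  rw [cechFrac_eq_iff]
  refine ⟨l, ?_⟩
  have e1 := h.proj_pow_smul I (γ + l • ∑ j ∈ I, δ j) m (l + k)
  have e2 := h.proj_pow_smul I (γ + k • ∑ j ∈ I, δ j) m (l + l)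
  rw [← e1, ← e2, pow_add, pow_add, hs]
  congr 1
  congr 1
  simp only [add_smul]
  abel

theorem CechProjections.locProj_mem (h : CechProjections f δ ℳ) (I : Finset (Fin r)) (γ : G)
    (y : CechLoc f M I) : h.locProj I γ y ∈ cechLocPiece f δ ℳ I γ := by
  obtain ⟨m, k, rfl⟩ := exists_cechFrac f y
  rw [h.locProj_cechFrac]
  exact cechFrac_mem_cechLocPiece (h.proj_mem _ _)

theorem CechProjections.locProj_of_mem (h : CechProjections f δ ℳ) {I : Finset (Fin r)} {γ : G}
    {y : CechLoc f M I} (hy : y ∈ cechLocPiece f δ ℳ I γ) : h.locProj I γ y = y := by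
  obtain ⟨k, m, hm, rfl⟩ := h.compatible.exists_of_mem_cechLocPiece hy
  rw [h.locProj_cechFrac, h.proj_of_mem hm]

theorem CechProjections.locProj_add (h : CechProjections f δ ℳ) (I : Finset (Fin r)) (γ : G)
    (y z : CechLoc f M I) : h.locProj I γ (y + z) = h.locProj I γ y + h.locProj I γ z := by
  obtain ⟨m, k, rfl⟩ := exists_cechFrac f y
  obtain ⟨m', k', rfl⟩ := exists_cechFrac f z
  rw [← cechFrac_smul_pow f m k k', ← cechFrac_smul_pow f m' k' k, add_comm k', ← cechFrac_add,
    h.locProj_cechFrac, h.locProj_cechFrac, h.locProj_cechFrac, map_add, cechFrac_add]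

/-- The projection of `M_{f_I}` to its piece of degree `γ`, as an additive map. -/
def CechProjections.locProjHom (h : CechProjections f δ ℳ) (I : Finset (Fin r)) (γ : G) :
    CechLoc f M I →+ CechLoc f M I :=
  AddMonoidHom.mk' (h.locProj I γ) (h.locProj_add I γ)

theorem CechProjections.locProj_restrict (h : CechProjections f δ ℳ) {I J : Finset (Fin r)}
    (hIJ : I ⊆ J) (γ : G) (y : CechLoc f M I) :
    h.locProj J γ (cechRestrict f M hIJ y) = cechRestrict f M hIJ (h.locProj I γ y) := by
  obtain ⟨m, k, rfl⟩ := exists_cechFrac f y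
  rw [h.locProj_cechFrac, cechRestrict_cechFrac, cechRestrict_cechFrac, h.locProj_cechFrac,
    ← h.proj_pow_smul]
  congr 3
  rw [← Finset.sum_sdiff hIJ, smul_add, add_comm (k • _), ← add_assoc]

/-- The projection of the Čech cochains to the piece of degree `γ`. -/
def CechProjections.cochainProj (h : CechProjections f δ ℳ) (p : ℕ) (γ : G)
    (x : CechCochain f M p) : CechCochain f M p :=
  fun I => h.locProj I.1 γ (x I)

theorem CechProjections.cechD_cochainProj (h : CechProjections f δ ℳ) (p : ℕ) (γ : G)
    (x : CechCochain f M p) :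
    cechD f M p (h.cochainProj p γ x) = h.cochainProj (p + 1) γ (cechD f M p x) := by
  ext J
  change _ = h.locProjHom J.1 γ _
  rw [cechD_apply, cechD_apply, map_sum]
  refine Finset.sum_congr rfl fun j _ => ?_
  have hc : cechComp f (h.cochainProj p γ x) (J.1.erase j) =
      h.locProj (J.1.erase j) γ (cechComp f x (J.1.erase j)) := by
    unfold cechComp
    split_ifs with hI
    · rfl
    · exact (map_zero (h.locProjHom (J.1.erase j) γ)).symm
  rw [hc, ← h.locProj_restrict]
  change _ • h.locProjHom J.1 γ _ = _
  rcases neg_one_pow_eq_or R ((J.1.filter (· < j)).card) with h1 | h1 <;> rw [h1]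
  · rw [one_smul, one_smul]
  · rw [neg_smul, one_smul, neg_smul, one_smul, map_neg]

/-- A homogeneous coboundary is the coboundary of a homogeneous cochain. -/
theorem CechProjections.exists_homogeneous_cechD (h : CechProjections f δ ℳ) {p : ℕ} {γ : G}
    {x : CechCochain f M (p + 1)} (hx : x ∈ cechPiece f δ ℳ (p + 1) γ)
    (hb : x ∈ cechBoundary f M (p + 1)) : ∃ y ∈ cechPiece f δ ℳ p γ, cechD f M p y = x := by
  obtain ⟨y, rfl⟩ := hb
  refine ⟨h.cochainProj p γ y, mem_cechPiece.2 fun I => h.locProj_mem _ _ _, ?_⟩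
  rw [h.cechD_cochainProj]
  funext J
  exact h.locProj_of_mem (mem_cechPiece.1 hx J)

end CechGrading

/-! ### Long exact sequences of local cohomology in a fixed degree. -/

section CechSequences

variable {R : Type*} [CommRing R] {r : ℕ} {f : Fin r → R}
variable {G : Type*} [AddCommGroup G] {δ : Fin r → G}
variable {L M N : Type*} [AddCommGroup L] [Module R L] [AddCommGroup M] [Module R M]
  [AddCommGroup N] [Module R N]
variable {ℒ : G → AddSubgroup L} {ℳ : G → AddSubgroup M} {𝒩 : G → AddSubgroup N}

theorem CechCompatible.cechMap_mem (hM : CechCompatible f δ ℳ) {φ : M →ₗ[R] N} {s : G}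
    (hφ : ∀ γ, ∀ m ∈ ℳ γ, φ m ∈ 𝒩 (γ + s)) {p : ℕ} {γ : G} {x : CechCochain f M p}
    (hx : x ∈ cechPiece f δ ℳ p γ) : cechMap f φ p x ∈ cechPiece f δ 𝒩 p (γ + s) := by
  rw [mem_cechPiece] at hx ⊢
  intro I
  obtain ⟨k, m, hm, h⟩ := hM.exists_of_mem_cechLocPiece (hx I)
  rw [cechMap_apply, h, cechLocMap_cechFrac]
  refine cechFrac_mem_cechLocPiece ?_
  rw [add_right_comm]
  exact hφ _ m hm

theorem CechCompatible.cechMap_mem' (hM : CechCompatible f δ ℳ) {φ : M →ₗ[R] N}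
    (hφ : ∀ γ, ∀ m ∈ ℳ γ, φ m ∈ 𝒩 γ) {p : ℕ} {γ : G} {x : CechCochain f M p}
    (hx : x ∈ cechPiece f δ ℳ p γ) : cechMap f φ p x ∈ cechPiece f δ 𝒩 p γ := by
  simpa using hM.cechMap_mem (𝒩 := 𝒩) (s := 0) (by simpa using hφ) hx

theorem CechCompatible.exists_cechMap_eq (hN : CechCompatible f δ 𝒩) {π : M →ₗ[R] N}
    (hπ : ∀ γ, ∀ n ∈ 𝒩 γ, ∃ m ∈ ℳ γ, π m = n) {p : ℕ} {γ : G} {x : CechCochain f N p}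
    (hx : x ∈ cechPiece f δ 𝒩 p γ) : ∃ y ∈ cechPiece f δ ℳ p γ, cechMap f π p y = x := by
  rw [mem_cechPiece] at hx
  have : ∀ I : {I : Finset (Fin r) // I.card = p},
      ∃ y ∈ cechLocPiece f δ ℳ I.1 γ, cechLocMap f π I.1 y = x I := by
    intro I
    obtain ⟨k, n, hn, h⟩ := hN.exists_of_mem_cechLocPiece (hx I)
    obtain ⟨m, hm, rfl⟩ := hπ _ n hn
    exact ⟨cechFrac f I.1 m k, cechFrac_mem_cechLocPiece hm, by rw [cechLocMap_cechFrac, h]⟩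
  choose y hy hyx using this
  exact ⟨y, mem_cechPiece.2 hy, funext hyx⟩

/-- Localization is exact degree by degree: if `m / f_I ^ k` maps to zero, some `f_I ^ l • m` is in
the kernel of `π`, is homogeneous, and lifts. -/
theorem CechCompatible.exists_cechMap_eq_of_exact (hM : CechCompatible f δ ℳ) {ι : L →ₗ[R] M}
    {π : M →ₗ[R] N} (hex : ∀ γ, ∀ m ∈ ℳ γ, π m = 0 → ∃ l ∈ ℒ γ, ι l = m) {p : ℕ} {γ : G}
    {y : CechCochain f M p} (hy : y ∈ cechPiece f δ ℳ p γ) (h0 : cechMap f π p y = 0) :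
    ∃ z ∈ cechPiece f δ ℒ p γ, cechMap f ι p z = y := by
  rw [mem_cechPiece] at hy
  have : ∀ I : {I : Finset (Fin r) // I.card = p},
      ∃ z ∈ cechLocPiece f δ ℒ I.1 γ, cechLocMap f ι I.1 z = y I := by
    intro I
    obtain ⟨k, m, hm, h⟩ := hM.exists_of_mem_cechLocPiece (hy I)
    have h1 := congrFun h0 I
    rw [cechMap_apply, h, cechLocMap_cechFrac, Pi.zero_apply, cechFrac_eq_zero_iff] at h1
    obtain ⟨l, hl⟩ := h1
    rw [← map_smul] at hl
    obtain ⟨z, hz, hz'⟩ := hex _ _ (hM.pow_smul_mem I.1 hm l) hl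
    refine ⟨cechFrac f I.1 z (k + l), cechFrac_mem_cechLocPiece ?_, ?_⟩
    · simpa only [add_smul, ← add_assoc] using hz
    · rw [cechLocMap_cechFrac, hz', cechFrac_smul_pow, h]
  choose z hz hzy using this
  exact ⟨z, mem_cechPiece.2 hz, funext hzy⟩

theorem cechMap_injective {φ : L →ₗ[R] M} (hφ : Function.Injective φ) (p : ℕ) :
    Function.Injective (cechMap f φ p) := by
  rw [injective_iff_map_eq_zero]
  intro x hx
  ext I
  have h := congrFun hx I
  obtain ⟨m, k, hm⟩ := exists_cechFrac f (x I)
  rw [cechMap_apply, hm, cechLocMap_cechFrac, Pi.zero_apply, cechFrac_eq_zero_iff] at h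
  obtain ⟨l, hl⟩ := h
  rw [hm, Pi.zero_apply, cechFrac_eq_zero_iff]
  exact ⟨l, hφ (by rw [map_smul, hl, map_zero])⟩

/-- In the long exact sequence of `0 → L → M → N → 0`, the vanishing of `H^p(M)_γ` and
`H^{p+1}(L)_γ` implies that of `H^p(N)_γ`. -/
theorem CechAcyclic.of_exact_right (hL : CechProjections f δ ℒ) (hM : CechCompatible f δ ℳ)
    (hN : CechCompatible f δ 𝒩) {ι : L →ₗ[R] M} {π : M →ₗ[R] N} (hι : Function.Injective ι)
    (hιg : ∀ γ, ∀ l ∈ ℒ γ, ι l ∈ ℳ γ) (hπ : ∀ γ, ∀ n ∈ 𝒩 γ, ∃ m ∈ ℳ γ, π m = n)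
    (hex : ∀ γ, ∀ m ∈ ℳ γ, π m = 0 → ∃ l ∈ ℒ γ, ι l = m) (h0 : π ∘ₗ ι = 0) {p : ℕ} {γ : G}
    (aM : CechAcyclic f δ ℳ p γ) (aL : CechAcyclic f δ ℒ (p + 1) γ) :
    CechAcyclic f δ 𝒩 p γ := by
  intro x hx hdx
  obtain ⟨y, hy, rfl⟩ := hN.exists_cechMap_eq hπ hx
  rw [← cechMap_cechD] at hdx
  obtain ⟨z, hz, hzy⟩ := hM.exists_cechMap_eq_of_exact hex (hM.cechD_mem hy) hdx
  have hdz : cechD f L (p + 1) z = 0 := by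
    apply cechMap_injective hι
    rw [cechMap_cechD, hzy, cechD_cechD, map_zero]
  -- A homogeneous `w` keeps `y - ι w` in degree `γ`, the only degree where `M` is known to be
  -- acyclic.
  obtain ⟨w, hw, rfl⟩ := hL.exists_homogeneous_cechD hz (aL z hz hdz)
  have h1 : y - cechMap f ι p w ∈ cechBoundary f M p := by
    refine aM _ (sub_mem hy (hL.compatible.cechMap_mem' hιg hw)) ?_
    rw [map_sub, ← cechMap_cechD, hzy, sub_self]
  have h2 := cechMap_mem_cechBoundary f π h1
  rwa [map_sub, cechMap_comp, h0, cechMap_zero, sub_zero] at h2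

/-- In the long exact sequence of `0 → L → M → N → 0`, the vanishing of `H^p(L)_γ` and
`H^p(N)_γ` implies that of `H^p(M)_γ`. -/
theorem CechAcyclic.of_exact_middle (hM : CechProjections f δ ℳ)
    (hN : CechProjections f δ 𝒩) {ι : L →ₗ[R] M} {π : M →ₗ[R] N} (hι : Function.Injective ι)
    (hπg : ∀ γ, ∀ m ∈ ℳ γ, π m ∈ 𝒩 γ) (hπ : ∀ γ, ∀ n ∈ 𝒩 γ, ∃ m ∈ ℳ γ, π m = n)
    (hex : ∀ γ, ∀ m ∈ ℳ γ, π m = 0 → ∃ l ∈ ℒ γ, ι l = m) {p : ℕ} {γ : G}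
    (aL : CechAcyclic f δ ℒ p γ) (aN : CechAcyclic f δ 𝒩 p γ) :
    CechAcyclic f δ ℳ p γ := by
  intro x hx hdx
  have hxN := hM.compatible.cechMap_mem' hπg hx
  have hb := aN _ hxN (by rw [← cechMap_cechD, hdx, map_zero])
  -- Lift the boundary `π x` to a homogeneous boundary `b`; then `x - b` comes from `L`. In degree
  -- `0` there are no boundaries, so `b = 0`.
  obtain ⟨b, hb, hbp, hbx⟩ : ∃ b ∈ cechBoundary f M p, b ∈ cechPiece f δ ℳ p γ ∧
      cechMap f π p b = cechMap f π p x := by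
    cases p with
    | zero =>
      refine ⟨0, zero_mem _, zero_mem _, ?_⟩
      rw [show cechMap f π 0 x = 0 from hb, map_zero]
    | succ p =>
      obtain ⟨w, hw, hwx⟩ := hN.exists_homogeneous_cechD hxN hb
      obtain ⟨v, hv, rfl⟩ := hN.compatible.exists_cechMap_eq hπ hw
      exact ⟨cechD f M p v, ⟨v, rfl⟩, hM.compatible.cechD_mem hv, by rw [cechMap_cechD, hwx]⟩
  obtain ⟨z, hz, hzx⟩ := hM.compatible.exists_cechMap_eq_of_exact hex (sub_mem hx hbp)
    (by rw [map_sub, hbx, sub_self])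
  have hdz : cechD f L p z = 0 := by
    apply cechMap_injective hι
    rw [cechMap_cechD, hzx, map_sub, hdx, cechD_of_mem_cechBoundary f hb, map_zero, sub_zero]
  have := cechMap_mem_cechBoundary f ι (aL z hz hdz)
  rw [hzx] at this
  simpa using add_mem this hb

/-- If multiplication by some `u ∈ 1 + √(f_j)` on `N` factors through the graded module `M`, the
vanishing of `H^p(M)_γ` implies that of `H^p(N)_γ`. -/
theorem CechAcyclic.of_factor (hN : CechCompatible f δ 𝒩) {μ : N →ₗ[R] M} {ι : M →ₗ[R] N}
    (hμ : ∀ γ, ∀ n ∈ 𝒩 γ, μ n ∈ ℳ γ) {u : R}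
    (hu : u - 1 ∈ (Ideal.span (Set.range f)).radical) (h : ι ∘ₗ μ = u • LinearMap.id)
    {p : ℕ} {γ : G} (aM : CechAcyclic f δ ℳ p γ) : CechAcyclic f δ 𝒩 p γ := by
  intro x hx hdx
  refine mem_cechBoundary_of_smul_mem f hdx hu ?_
  rw [← cechMap_smul_id, ← h, ← cechMap_comp]
  refine cechMap_mem_cechBoundary f ι (aM _ (hN.cechMap_mem' hμ hx) ?_)
  rw [← cechMap_cechD, hdx, map_zero]

/-- If the identity of `N` is a sum of maps which factor through shifts of graded modules `M`
with `H^p(M)_{γ + s i} = 0`, then `H^p(N)_γ = 0`. -/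
theorem CechAcyclic.of_sum {κ : Type*} [Fintype κ] (hN : CechCompatible f δ 𝒩)
    {μ : κ → N →ₗ[R] M} {ι : κ → M →ₗ[R] N} {s : κ → G}
    (hμ : ∀ i γ, ∀ n ∈ 𝒩 γ, μ i n ∈ ℳ (γ + s i)) (h : ∑ i, ι i ∘ₗ μ i = LinearMap.id)
    {p : ℕ} {γ : G} (aM : ∀ i, CechAcyclic f δ ℳ p (γ + s i)) : CechAcyclic f δ 𝒩 p γ := by
  intro x hx hdx
  rw [← cechMap_id f p x, ← h, cechMap_sum]
  refine sum_mem fun i _ => ?_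
  rw [← cechMap_comp]
  refine cechMap_mem_cechBoundary f (ι i) (aM i _ (hN.cechMap_mem (hμ i) hx) ?_)
  rw [← cechMap_cechD, hdx, map_zero]

/-- There are no subsets of `Fin r` with more than `r` elements; this ends the dimension shifting.
-/
theorem CechAcyclic.of_lt {p : ℕ} (hp : r < p) (ℳ : G → AddSubgroup M) (γ : G) :
    CechAcyclic f δ ℳ p γ := by
  intro x _ _
  have : x = 0 := by
    ext I
    have := Finset.card_le_univ I.1
    rw [I.2, Fintype.card_fin] at this
    omega
  rw [this]
  exact zero_mem _

end CechSequences

/-! ### Grothendieck vanishing, and the cohomological dimension of a polynomial ring over a field.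
-/

section CohomologicalDimension

universe u

variable {R : Type u} [CommRing R] {r : ℕ} {f : Fin r → R}
variable {L M N : Type*} [AddCommGroup L] [Module R L] [AddCommGroup M] [Module R M]
  [AddCommGroup N] [Module R N]

variable (f N) in
/-- The vanishing of `H^p(N)`, without a grading. -/
def CechVanishing (p : ℕ) : Prop :=
  ∀ x : CechCochain f N p, cechD f N p x = 0 → x ∈ cechBoundary f N p

theorem nontrivial_localCohomology_of_not_cechVanishing {p : ℕ} (h : ¬ CechVanishing f N p) :
    Nontrivial (LocalCohomology f N p) := by
  by_contra hn
  rw [not_nontrivial_iff_subsingleton] at hn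
  refine h fun x hx => ?_
  exact (Submodule.Quotient.mk_eq_zero ((cechBoundary f N p).submoduleOf _)).1
    (Subsingleton.elim (Submodule.Quotient.mk ⟨x, hx⟩ : LocalCohomology f N p) 0)

theorem CechVanishing.subsingleton_localCohomology {p : ℕ} (h : CechVanishing f N p) :
    Subsingleton (LocalCohomology f N p) := by
  refine subsingleton_of_forall_eq 0 fun y => ?_
  obtain ⟨⟨x, hx⟩, rfl⟩ := Submodule.Quotient.mk_surjective _ y
  exact (Submodule.Quotient.mk_eq_zero ((cechBoundary f N p).submoduleOf _)).2 (h x hx)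

theorem CechVanishing.cechAcyclic {G : Type*} [AddCommGroup G] {δ : Fin r → G}
    (𝒩 : G → AddSubgroup N) {p : ℕ} (h : CechVanishing f N p) (γ : G) :
    CechAcyclic f δ 𝒩 p γ := fun x _ hx => h x hx

variable (f N) in
/-- The projection for the grading with a single piece. -/
def trivialProjections : CechProjections f (0 : Fin r → Unit) (fun _ => (⊤ : AddSubgroup N)) where
  proj _ := AddMonoidHom.id N
  proj_mem _ _ := AddSubgroup.mem_top _
  proj_of_mem _ := rfl
  proj_smul _ _ _ := rfl

theorem mem_cechPiece_trivial {p : ℕ} (x : CechCochain f N p) :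
    x ∈ cechPiece f (0 : Fin r → Unit) (fun _ => (⊤ : AddSubgroup N)) p () := by
  rw [mem_cechPiece]
  intro I
  obtain ⟨m, k, h⟩ := exists_cechFrac f (x I)
  rw [h]
  exact cechFrac_mem_cechLocPiece (AddSubgroup.mem_top _)

/-- The ungraded case is the grading by the trivial group, so the graded exact sequences apply to
it. -/
theorem cechVanishing_iff {p : ℕ} : CechVanishing f N p ↔
    CechAcyclic f (0 : Fin r → Unit) (fun _ => (⊤ : AddSubgroup N)) p () :=
  ⟨fun h => h.cechAcyclic _ _, fun h x hx => h x (mem_cechPiece_trivial x) hx⟩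

theorem CechVanishing.of_exact {ι : L →ₗ[R] M} {π : M →ₗ[R] N} (hι : Function.Injective ι)
    (hπ : Function.Surjective π) (hex : Function.Exact ι π) {p : ℕ}
    (aL : CechVanishing f L p) (aN : CechVanishing f N p) : CechVanishing f M p := by
  rw [cechVanishing_iff] at *
  refine CechAcyclic.of_exact_middle (π := π) (trivialProjections f M)
    (trivialProjections f N) hι
    (fun _ _ _ => AddSubgroup.mem_top _) (fun _ n _ => ?_) (fun _ m _ hm => ?_) aL aN
  · obtain ⟨m, rfl⟩ := hπ n
    exact ⟨m, AddSubgroup.mem_top _, rfl⟩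
  · obtain ⟨l, rfl⟩ := (hex m).1 hm
    exact ⟨l, AddSubgroup.mem_top _, rfl⟩

/-- If `f j` is regular on `N` and `H^p(N / f j N) = 0`, then `H^{p+1}(N) = 0`. -/
theorem CechVanishing.of_isSMulRegular (j : Fin r) (hj : IsSMulRegular N (f j)) {p : ℕ}
    (h : CechVanishing f (QuotSMulTop (f j) N) p) : CechVanishing f N (p + 1) := by
  -- Multiplication by `f j` is injective on `H^{p+1}(N)`: its kernel is the image of `H^p(N / f j
  -- N) = 0` under the connecting map.
  have key : ∀ ξ : CechCochain f N (p + 1), f j • ξ ∈ cechBoundary f N (p + 1) →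
      ξ ∈ cechBoundary f N (p + 1) := by
    rintro ξ ⟨y, hy⟩
    let μ : N →ₗ[R] N := f j • LinearMap.id
    let π : N →ₗ[R] QuotSMulTop (f j) N := Submodule.mkQ _
    have hμ : Function.Injective μ := hj
    have hπ : ∀ _ : Unit, ∀ n ∈ (⊤ : AddSubgroup (QuotSMulTop (f j) N)),
        ∃ m ∈ (⊤ : AddSubgroup N), π m = n := fun _ n _ => by
      obtain ⟨m, rfl⟩ := Submodule.mkQ_surjective _ n
      exact ⟨m, AddSubgroup.mem_top _, rfl⟩
    have hex : ∀ _ : Unit, ∀ m ∈ (⊤ : AddSubgroup N), π m = 0 →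
        ∃ l ∈ (⊤ : AddSubgroup N), μ l = m := fun _ m _ hm => by
      have hm' : m ∈ f j • (⊤ : Submodule R N) := (Submodule.Quotient.mk_eq_zero _).1 hm
      obtain ⟨l, -, rfl⟩ := (Submodule.mem_smul_pointwise_iff_exists _ _ _).1 hm'
      exact ⟨l, AddSubgroup.mem_top _, rfl⟩
    have hπμ : π ∘ₗ μ = 0 := by
      ext n
      exact (Submodule.Quotient.mk_eq_zero _).2 (Submodule.smul_mem_pointwise_smul _ _ _ trivial)
    have hb := h (cechMap f π p y) (by
      rw [← cechMap_cechD, hy, ← cechMap_smul_id, cechMap_comp, hπμ, cechMap_zero])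
    obtain ⟨b, hb, hby⟩ : ∃ b ∈ cechBoundary f N p, cechMap f π p b = cechMap f π p y := by
      cases p with
      | zero => exact ⟨0, zero_mem _, by rw [show cechMap f π 0 y = 0 from hb, map_zero]⟩
      | succ p =>
        obtain ⟨w, hw⟩ := hb
        obtain ⟨v, -, rfl⟩ := (trivialProjections f _).compatible.exists_cechMap_eq hπ
          (mem_cechPiece_trivial w)
        exact ⟨cechD f N p v, ⟨v, rfl⟩, by rw [cechMap_cechD, hw]⟩
    obtain ⟨t, -, ht⟩ := (trivialProjections f N).compatible.exists_cechMap_eq_of_exact hex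
      (mem_cechPiece_trivial (y - b)) (by rw [map_sub, hby, sub_self])
    refine ⟨t, cechMap_injective hμ _ ?_⟩
    rw [cechMap_cechD, ht, map_sub, hy, cechD_of_mem_cechBoundary f hb, sub_zero, cechMap_smul_id]
  intro x hx
  -- Some power of `f j` kills the class, and injectivity strips it off one factor at a time.
  obtain ⟨k, hk⟩ := exists_pow_smul_mem_cechBoundary f hx j
  induction k with
  | zero => simpa using hk
  | succ k ih =>
    rw [pow_succ', mul_smul] at hk
    exact ih (key _ hk)

/-- If all the `f j` kill `N`, the higher local cohomology of `N` vanishes. -/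
theorem CechVanishing.of_smul_eq_zero (h : ∀ j, ∀ n : N, f j • n = 0) (p : ℕ) :
    CechVanishing f N (p + 1) := by
  intro x _
  have : x = 0 := by
    ext I
    obtain ⟨m, k, hm⟩ := exists_cechFrac f (x I)
    rw [hm, Pi.zero_apply, cechFrac_eq_zero_iff]
    obtain ⟨j, hj⟩ : I.1.Nonempty := Finset.card_pos.1 (by rw [I.2]; omega)
    refine ⟨1, ?_⟩
    rw [pow_one, ← Finset.mul_prod_erase _ _ hj, mul_smul, h]
  rw [this]
  exact zero_mem _

theorem CechVanishing.of_subsingleton [Subsingleton N] (p : ℕ) : CechVanishing f N p := by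
  cases p with
  | zero =>
    intro x _
    have : x = 0 := by
      ext I
      obtain ⟨m, k, hm⟩ := exists_cechFrac f (x I)
      rw [hm, Subsingleton.elim m 0, cechFrac_zero]; rfl
    rw [this]; exact zero_mem _
  | succ p => exact CechVanishing.of_smul_eq_zero (fun _ _ => Subsingleton.elim _ _) p

/-- Grothendieck vanishing: `H^p(N) = 0` for `p > dim N`. -/
theorem cechVanishing_of_supportDim_lt [IsNoetherianRing R] (d : ℕ) :
    ∀ (N : Type u) [AddCommGroup N] [Module R N] [Module.Finite R N],
      Module.supportDim R N < d → ∀ p ≥ d, CechVanishing f N p := by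
  induction d with
  | zero =>
    intro N _ _ _ h p _
    -- A support dimension below `0` is `-∞`, so `N = 0`.
    have : Subsingleton N := by
      by_contra hn
      rw [not_subsingleton_iff_nontrivial] at hn
      have h0 := Module.supportDim_ne_bot_of_nontrivial R N
      exact h0 ((WithBot.lt_coe_bot (α := ℕ∞)).1 (by simpa using h))
    exact CechVanishing.of_subsingleton p
  | succ d ih =>
    intro N _ _ hfin
    induction hfin using IsNoetherianRing.induction_on_isQuotientEquivQuotientPrime R with
    | subsingleton N => exact fun _ p _ => CechVanishing.of_subsingleton p
    | quotient N P e =>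
      intro h p hp
      obtain ⟨q, rfl⟩ : ∃ q, p = q + 1 := ⟨p - 1, by omega⟩
      have hann : Module.annihilator R N = P.1 := by
        rw [e.annihilator_eq, Ideal.annihilator_quotient]
      by_cases hP : ∀ j, f j ∈ P.1
      -- Either all `f j` kill `R / P`, and the positive-degree cochains are zero, or some `f j` is
      -- regular on `R / P` and the quotient by it has smaller dimension.
      · refine CechVanishing.of_smul_eq_zero (fun j n => ?_) q
        have := hP j
        rw [← hann, Module.mem_annihilator] at this
        exact this n
      · push Not at hP
        obtain ⟨j, hj⟩ := hP
        have hreg : IsSMulRegular N (f j) := by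
          have hP' := P.2
          rw [e.isSMulRegular_congr]
          intro a b hab
          obtain ⟨a, rfl⟩ := Ideal.Quotient.mk_surjective a
          obtain ⟨b, rfl⟩ := Ideal.Quotient.mk_surjective b
          have h1 : f j * (a - b) ∈ P.1 := by
            rw [mul_sub]
            exact (Ideal.Quotient.mk_eq_mk_iff_sub_mem _ _).1 hab
          exact (Ideal.Quotient.mk_eq_mk_iff_sub_mem _ _).2
            ((hP'.mem_or_mem h1).resolve_left hj)
        refine CechVanishing.of_isSMulRegular j hreg (ih _ ?_ q (by omega))
        -- The annihilator is `P`, whose only minimal prime is `P` itself; as `f j ∉ P`, the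
        -- dimension drops by at least one.
        have h1 := Module.supportDim_quotSMulTop_succ_le_of_notMem_minimalPrimes
          (R := R) (M := N) (x := f j) (by
            rw [hann]
            have hP' := P.2
            intro p hp
            rw [Ideal.minimalPrimes_eq_subsingleton_self] at hp
            rw [Set.mem_singleton_iff.1 hp]
            exact hj)
        by_contra hn
        rw [not_lt] at hn
        refine absurd h (not_lt.2 (le_trans ?_ h1))
        push_cast
        gcongr
    | exact N₁ N₂ N₃ φ ψ hφ hψ hex ih₁ ih₃ =>
      intro h p hp
      exact CechVanishing.of_exact hφ hψ hex
        (ih₁ ((Module.supportDim_le_of_injective φ hφ).trans_lt h) p hp)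
        (ih₃ ((Module.supportDim_le_of_surjective ψ hψ).trans_lt h) p hp)

/-- The local cohomology of a polynomial ring in `n` variables over a field vanishes above `n`. -/
theorem cechVanishing_mvPolynomial {S : Type u} [CommRing S] (hS : IsField S) {n : ℕ}
    {f : Fin r → MvPolynomial (Fin n) S} {p : ℕ} (hp : n < p) :
    CechVanishing f (MvPolynomial (Fin n) S) p := by
  let _ := hS.toField
  refine cechVanishing_of_supportDim_lt (n + 1) _ ?_ p hp
  rw [Module.supportDim_self_eq_ringKrullDim, MvPolynomial.ringKrullDim_of_isNoetherianRing,
    ringKrullDim_eq_zero_of_isField hS]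
  simp only [Nat.card_eq_fintype_card, Fintype.card_fin, zero_add]
  exact_mod_cast Nat.lt_succ_self n

end CohomologicalDimension

/-! ### The ideal `(X_1, …, X_n)` and degrees. -/

section Irrelevant

variable {S G : Type*} [CommRing S] [AddCommGroup G] {n : ℕ} {deg : Fin n → G}

theorem mem_irrelevant_iff {a : MvPolynomial (Fin n) S} :
    a ∈ irrelevant S n ↔ MvPolynomial.coeff 0 a = 0 := by
  rw [irrelevant, ← Set.image_univ, MvPolynomial.mem_ideal_span_X_image]
  constructor
  · intro h
    by_contra h0
    obtain ⟨i, -, hi⟩ := h 0 (MvPolynomial.mem_support_iff.2 h0)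
    simp at hi
  · intro h d hd
    obtain ⟨i, hi⟩ := Finsupp.ne_iff.1
      (fun h0 : d = 0 => MvPolynomial.mem_support_iff.1 hd (h0 ▸ h))
    exact ⟨i, trivial, hi⟩

theorem mem_irrelevant_of_mem_polyPiece {a : MvPolynomial (Fin n) S} {α : G}
    (ha : a ∈ polyPiece deg S α) (hα : α ≠ 0) : a ∈ irrelevant S n := by
  rw [mem_irrelevant_iff]
  exact MvPolynomial.IsWeightedHomogeneous.coeff_eq_zero ha 0 (by simpa using hα.symm)

/-- This turns the hypothesis on monomials into one on polynomials: an element of `(X)` of degree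
`0` is a combination of monomials of degree `0` other than `1`. -/
theorem mem_of_mem_polyPiece_zero {a : MvPolynomial (Fin n) S} (ha : a ∈ polyPiece deg S 0)
    (ha0 : a ∈ irrelevant S n) {J : Ideal (MvPolynomial (Fin n) S)}
    (hJ : ∀ d : Fin n →₀ ℕ, d ≠ 0 → Finsupp.weight deg d = 0 →
      MvPolynomial.monomial d (1 : S) ∈ J) : a ∈ J := by
  rw [← MvPolynomial.support_sum_monomial_coeff a]
  refine sum_mem fun d hd => ?_
  rw [MvPolynomial.mem_support_iff] at hd
  rw [mem_irrelevant_iff] at ha0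
  have h := J.mul_mem_left (MvPolynomial.C (MvPolynomial.coeff d a))
    (hJ d (fun h => hd (h ▸ ha0)) (ha hd))
  rwa [MvPolynomial.C_mul_monomial, mul_one] at h

end Irrelevant

/-! ### Induced gradings on submodules. -/

section SubPiece

variable {G R M : Type*} [CommRing R] [AddCommGroup M] [Module R M] (ℳ : G → AddSubgroup M)

/-- The grading of a submodule induced by a grading of the module. -/
def subPiece (Z : Submodule R M) (γ : G) : AddSubgroup Z :=
  (ℳ γ).comap Z.subtype.toAddMonoidHom

variable {ℳ}

theorem mem_subPiece {Z : Submodule R M} {γ : G} {z : Z} : z ∈ subPiece ℳ Z γ ↔ (z : M) ∈ ℳ γ :=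
  Iff.rfl

end SubPiece

/-! ### Graded modules through their projections; graded free modules; graded Nakayama. -/

section GradedModules

variable {S G : Type*} [CommRing S] [AddCommGroup G] {n : ℕ} (deg : Fin n → G)
variable {M N : Type*} [AddCommGroup M] [Module (MvPolynomial (Fin n) S) M]
  [AddCommGroup N] [Module (MvPolynomial (Fin n) S) N]

/-- The projections of a graded module to its graded pieces. -/
structure GradedProjections (ℳ : G → AddSubgroup M) where
  proj : G → M →+ M
  proj_mem : ∀ γ m, proj γ m ∈ ℳ γ
  proj_of_mem : ∀ {γ m}, m ∈ ℳ γ → proj γ m = m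
  proj_of_ne : ∀ {γ γ' m}, m ∈ ℳ γ → γ ≠ γ' → proj γ' m = 0
  mem_closure : ∀ m, m ∈ AddSubgroup.closure (⋃ γ, (ℳ γ : Set M))
  smul_mem : ∀ {α β} {a : MvPolynomial (Fin n) S} {m}, a ∈ polyPiece deg S α → m ∈ ℳ β →
    a • m ∈ ℳ (α + β)

variable {deg} {ℳ : G → AddSubgroup M} {𝒩 : G → AddSubgroup N}

namespace GradedProjections

theorem induction_on (h : GradedProjections (S := S) deg ℳ) {P : M → Prop} (m : M)
    (homogeneous : ∀ γ, ∀ m ∈ ℳ γ, P m) (add : ∀ m m', P m → P m' → P (m + m')) : P m := by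
  -- Carrying `P (-m)` along handles negation in the closure, for which `P` has no hypothesis.
  refine (AddSubgroup.closure_induction (p := fun m _ => P m ∧ P (-m)) ?_ ?_ ?_ ?_
    (h.mem_closure m)).1
  · intro m hm
    obtain ⟨γ, hm⟩ := Set.mem_iUnion.1 hm
    exact ⟨homogeneous γ m hm, homogeneous γ _ (neg_mem hm)⟩
  · rw [neg_zero]
    exact ⟨homogeneous 0 0 (zero_mem _), homogeneous 0 0 (zero_mem _)⟩
  · intro x y _ _ hx hy
    rw [neg_add]
    exact ⟨add _ _ hx.1 hy.1, add _ _ hx.2 hy.2⟩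
  · intro x _ hx
    rw [neg_neg]
    exact ⟨hx.2, hx.1⟩

theorem exists_sum (h : GradedProjections (S := S) deg ℳ) (m : M) :
    ∃ s : Finset G, ∑ γ ∈ s, h.proj γ m = m := by
  classical
  induction m using h.induction_on with
  | homogeneous γ m hm => exact ⟨{γ}, by rw [Finset.sum_singleton, h.proj_of_mem hm]⟩
  | add m m' hm hm' =>
    obtain ⟨s, hs⟩ := hm
    obtain ⟨s', hs'⟩ := hm'
    have key : ∀ (m : M) (s t : Finset G), ∑ γ ∈ s, h.proj γ m = m → s ⊆ t →
        ∑ γ ∈ t, h.proj γ m = m := by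
      intro m s t hs hst
      rw [← Finset.sum_subset hst, hs]
      intro γ _ hγ
      rw [← hs, map_sum]
      refine Finset.sum_eq_zero fun γ' hγ' => ?_
      exact h.proj_of_ne (h.proj_mem _ _) (fun e => hγ (e ▸ hγ'))
    refine ⟨s ∪ s', ?_⟩
    simp only [map_add, Finset.sum_add_distrib]
    rw [key m s _ hs Finset.subset_union_left, key m' s' _ hs' Finset.subset_union_right]

theorem proj_smul (h : GradedProjections (S := S) deg ℳ) {α : G} {a : MvPolynomial (Fin n) S}
    (ha : a ∈ polyPiece deg S α) (γ : G) (m : M) :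
    h.proj (α + γ) (a • m) = a • h.proj γ m := by
  induction m using h.induction_on with
  | homogeneous β m hm =>
    by_cases hβ : β = γ
    · subst hβ
      rw [h.proj_of_mem hm, h.proj_of_mem (h.smul_mem ha hm)]
    · rw [h.proj_of_ne hm hβ, smul_zero, h.proj_of_ne (h.smul_mem ha hm)]
      exact fun e => hβ (add_left_cancel e)
  | add m m' hm hm' => rw [smul_add, map_add, map_add, smul_add, hm, hm']

theorem map_proj (h : GradedProjections (S := S) deg ℳ) (h' : GradedProjections (S := S) deg 𝒩)
    {φ : M →+ N} (hφ : ∀ γ, ∀ m ∈ ℳ γ, φ m ∈ 𝒩 γ) (γ : G) (m : M) :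
    φ (h.proj γ m) = h'.proj γ (φ m) := by
  induction m using h.induction_on with
  | homogeneous β m hm =>
    by_cases hβ : β = γ
    · subst hβ
      rw [h.proj_of_mem hm, h'.proj_of_mem (hφ _ _ hm)]
    · rw [h.proj_of_ne hm hβ, map_zero, h'.proj_of_ne (hφ _ _ hm) hβ]
  | add m m' hm hm' => rw [map_add, map_add, map_add, map_add, hm, hm']

/-- A homogeneous element in the image of a graded map is the image of a homogeneous element. -/
theorem exists_homogeneous_preimage (h : GradedProjections (S := S) deg ℳ)
    (h' : GradedProjections (S := S) deg 𝒩) {φ : M →ₗ[MvPolynomial (Fin n) S] N}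
    (hφ : ∀ γ, ∀ m ∈ ℳ γ, φ m ∈ 𝒩 γ) {γ : G} {m : M} (hm : φ m ∈ 𝒩 γ) :
    ∃ m' ∈ ℳ γ, φ m' = φ m :=
  ⟨h.proj γ m, h.proj_mem _ _, by
    rw [← h'.proj_of_mem hm]
    exact h.map_proj h' (φ := φ.toAddMonoidHom) hφ γ m⟩

/-- The projections needed for the Čech complex of homogeneous polynomials `f j`. -/
def cechProjections (h : GradedProjections (S := S) deg ℳ) {r : ℕ}
    {f : Fin r → MvPolynomial (Fin n) S} {δ : Fin r → G} (hf : ∀ j, f j ∈ polyPiece deg S (δ j)) :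
    CechProjections f δ ℳ where
  proj := h.proj
  proj_mem := h.proj_mem
  proj_of_mem := h.proj_of_mem
  proj_smul j γ m := by rw [add_comm, h.proj_smul (hf j)]

/-- The grading of a submodule stable under the projections. -/
def sub (h : GradedProjections (S := S) deg ℳ) (Z : Submodule (MvPolynomial (Fin n) S) M)
    (hZ : ∀ γ, ∀ z ∈ Z, h.proj γ z ∈ Z) : GradedProjections (S := S) deg (subPiece ℳ Z) where
  proj γ := ((h.proj γ).comp Z.subtype.toAddMonoidHom).codRestrict Z.toAddSubgroup
    fun z => hZ γ z z.2
  proj_mem γ z := h.proj_mem γ z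
  proj_of_mem hz := Subtype.ext (h.proj_of_mem hz)
  proj_of_ne hz hne := Subtype.ext (h.proj_of_ne hz hne)
  mem_closure z := by
    obtain ⟨s, hs⟩ := h.exists_sum (z : M)
    have : z = ∑ γ ∈ s, (⟨h.proj γ z, hZ γ z z.2⟩ : Z) := by
      ext; simp [hs]
    rw [this]
    exact sum_mem fun γ _ => AddSubgroup.subset_closure (Set.mem_iUnion.2 ⟨γ, h.proj_mem γ z⟩)
  smul_mem ha hz := h.smul_mem ha hz

variable (deg S) in
/-- The projections of the polynomial ring to its graded pieces. -/
def poly : GradedProjections (S := S) deg (polyPiece deg S) where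
  proj γ := (MvPolynomial.weightedHomogeneousComponent deg γ).toAddMonoidHom
  proj_mem γ m := MvPolynomial.weightedHomogeneousComponent_mem deg m γ
  proj_of_mem hm := MvPolynomial.IsWeightedHomogeneous.weightedHomogeneousComponent_same hm
  proj_of_ne hm hne :=
    MvPolynomial.IsWeightedHomogeneous.weightedHomogeneousComponent_ne _ hm hne.symm
  mem_closure a := by
    rw [← MvPolynomial.support_sum_monomial_coeff a]
    exact sum_mem fun d _ => AddSubgroup.subset_closure (Set.mem_iUnion.2
      ⟨_, MvPolynomial.isWeightedHomogeneous_monomial deg d _ rfl⟩)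
  smul_mem ha hm := MvPolynomial.IsWeightedHomogeneous.mul ha hm

/-- The projections given by a decomposition of a module. -/
def ofDecomposition [DecidableEq G] (ℳ : G → AddSubgroup M) [DirectSum.Decomposition ℳ]
    [SetLike.GradedSMul (MvPolynomial.weightedHomogeneousSubmodule S deg) ℳ] :
    GradedProjections (S := S) deg ℳ where
  proj γ := (ℳ γ).subtype.comp ((DFinsupp.evalAddMonoidHom γ).comp
    (DirectSum.decomposeAddEquiv ℳ).toAddMonoidHom)
  proj_mem γ m := (DirectSum.decompose ℳ m γ).2
  proj_of_mem hm := DirectSum.decompose_of_mem_same ℳ hm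
  proj_of_ne hm hne := DirectSum.decompose_of_mem_ne ℳ hm hne
  mem_closure m := by
    induction m using DirectSum.Decomposition.inductionOn ℳ with
    | zero => exact zero_mem _
    | homogeneous m => exact AddSubgroup.subset_closure (Set.mem_iUnion.2 ⟨_, m.2⟩)
    | add m m' hm hm' => exact add_mem hm hm'
  smul_mem ha hm := SetLike.GradedSMul.smul_mem
    (A := MvPolynomial.weightedHomogeneousSubmodule S deg) ha hm

end GradedProjections

theorem single_mem_freePiece {ι : Type*} (e : ι → G) (k : ι) {γ : G} {a : MvPolynomial (Fin n) S}
    (ha : a ∈ polyPiece deg S (γ - e k)) : Finsupp.single k a ∈ freePiece deg e γ := by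
  classical
  intro k'
  by_cases h : k = k'
  · subst h; simpa using ha
  · rw [Finsupp.single_eq_of_ne' h]; exact zero_mem _

theorem one_mem_polyPiece : (1 : MvPolynomial (Fin n) S) ∈ polyPiece deg S 0 :=
  MvPolynomial.isWeightedHomogeneous_one S deg

theorem single_one_mem_freePiece {ι : Type*} (e : ι → G) (k : ι) :
    Finsupp.single k (1 : MvPolynomial (Fin n) S) ∈ freePiece deg e (e k) :=
  single_mem_freePiece e k (by rw [sub_self]; exact one_mem_polyPiece)

theorem mem_closure_freePiece {ι : Type*} (e : ι → G) (x : ι →₀ MvPolynomial (Fin n) S) :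
    x ∈ AddSubgroup.closure (⋃ γ, (freePiece (S := S) deg e γ : Set _)) := by
  classical
  induction x using Finsupp.induction_linear with
  | zero => exact zero_mem _
  | add x y hx hy => exact add_mem hx hy
  | single k a =>
    induction a using (GradedProjections.poly (S := S) deg).induction_on with
    | homogeneous γ a ha =>
      refine AddSubgroup.subset_closure (Set.mem_iUnion.2 ⟨γ + e k, single_mem_freePiece e k ?_⟩)
      rwa [add_sub_cancel_right]
    | add a b ha hb => rw [Finsupp.single_add]; exact add_mem ha hb

variable (deg S) in
/-- The projections of a graded free module to its graded pieces. -/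
def GradedProjections.free {ι : Type*} (e : ι → G) :
    GradedProjections (S := S) deg (freePiece (S := S) deg e) where
  proj γ := AddMonoidHom.mk'
    (fun x => Finsupp.onFinset x.support
      (fun k => MvPolynomial.weightedHomogeneousComponent deg (γ - e k) (x k)) fun k hk => by
        rw [Finsupp.mem_support_iff]
        exact fun h => hk (by rw [h, map_zero]))
    fun x y => by ext1 k; simp
  proj_mem γ x k := MvPolynomial.weightedHomogeneousComponent_mem deg (x k) (γ - e k)
  proj_of_mem {γ x} hx := by
    ext1 k
    exact MvPolynomial.IsWeightedHomogeneous.weightedHomogeneousComponent_same (hx k)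
  proj_of_ne {γ γ' x} hx hne := by
    ext1 k
    exact MvPolynomial.IsWeightedHomogeneous.weightedHomogeneousComponent_ne _ (hx k)
      fun h => hne (sub_left_inj.1 h).symm
  mem_closure := mem_closure_freePiece e
  smul_mem {α β a x} ha hx k := by
    rw [add_sub_assoc]
    exact MvPolynomial.IsWeightedHomogeneous.mul ha (hx k)

theorem linearCombination_mem {ι : Type*} {e : ι → G} (h : GradedProjections (S := S) deg 𝒩)
    {v : ι → N} (hv : ∀ k, v k ∈ 𝒩 (e k)) {γ : G} {x : ι →₀ MvPolynomial (Fin n) S}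
    (hx : x ∈ freePiece deg e γ) : Finsupp.linearCombination _ v x ∈ 𝒩 γ := by
  rw [Finsupp.linearCombination_apply]
  refine sum_mem fun k _ => ?_
  have := h.smul_mem (hx k) (hv k)
  rwa [sub_add_cancel] at this

theorem mem_smul_top_of_forall_mem {ι : Type*} {I : Ideal (MvPolynomial (Fin n) S)}
    {x : ι →₀ MvPolynomial (Fin n) S} (hx : ∀ k, x k ∈ I) :
    x ∈ I • (⊤ : Submodule (MvPolynomial (Fin n) S) (ι →₀ MvPolynomial (Fin n) S)) := by
  rw [← Finsupp.sum_single x]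
  refine sum_mem fun k _ => ?_
  have := Submodule.smul_mem_smul (hx k) (Submodule.mem_top (R := MvPolynomial (Fin n) S)
    (x := Finsupp.single k (1 : MvPolynomial (Fin n) S)))
  rwa [Finsupp.smul_single_one] at this

theorem map_mem_smul_top {I : Ideal (MvPolynomial (Fin n) S)}
    (φ : M →ₗ[MvPolynomial (Fin n) S] N) {x : M}
    (hx : x ∈ I • (⊤ : Submodule (MvPolynomial (Fin n) S) M)) :
    φ x ∈ I • (⊤ : Submodule (MvPolynomial (Fin n) S) N) := by
  have h := Submodule.mem_map_of_mem (f := φ) hx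
  rw [Submodule.map_smul''] at h
  exact Submodule.smul_mono le_rfl le_top h

/-- Graded Nakayama lemma. -/
theorem GradedProjections.exists_degree_zero_smul_mem (h : GradedProjections (S := S) deg 𝒩)
    [Module.Finite (MvPolynomial (Fin n) S) N] {N' : Submodule (MvPolynomial (Fin n) S) N}
    (hN' : ∀ γ, ∀ m ∈ N', h.proj γ m ∈ N')
    (hle : ⊤ ≤ N' ⊔ irrelevant S n • (⊤ : Submodule (MvPolynomial (Fin n) S) N)) :
    ∃ u ∈ polyPiece deg S 0, u - 1 ∈ irrelevant S n ∧ ∀ m, u • m ∈ N' := by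
  classical
  obtain ⟨a, ha, hsmul⟩ := Submodule.exists_sub_one_mem_and_smul_le_of_fg_of_le_sup
    Module.Finite.fg_top le_rfl hle
  -- The Nakayama element `a` need not be homogeneous. Its component of degree `0` keeps the
  -- constant term `1`, and on `m` of degree `γ` it gives the degree `γ` part of `a • m`, which
  -- stays in the graded submodule `N'`.
  refine ⟨MvPolynomial.weightedHomogeneousComponent deg 0 a,
    MvPolynomial.weightedHomogeneousComponent_mem deg a 0, ?_, fun m => ?_⟩
  · rw [mem_irrelevant_iff] at ha ⊢
    rw [MvPolynomial.coeff_sub, MvPolynomial.coeff_weightedHomogeneousComponent] at *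
    simpa using ha
  · have key : ∀ (a : MvPolynomial (Fin n) S) (γ : G), ∀ m ∈ 𝒩 γ, h.proj γ (a • m) =
        MvPolynomial.weightedHomogeneousComponent deg 0 a • m := by
      intro a γ m hm
      induction a using (GradedProjections.poly (S := S) deg).induction_on with
      | homogeneous α a ha =>
        by_cases hα : α = 0
        · subst hα
          rw [MvPolynomial.IsWeightedHomogeneous.weightedHomogeneousComponent_same ha,
            h.proj_of_mem]
          simpa using h.smul_mem ha hm
        · rw [MvPolynomial.IsWeightedHomogeneous.weightedHomogeneousComponent_ne _ ha (Ne.symm hα),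
            zero_smul, h.proj_of_ne (h.smul_mem ha hm)]
          simpa using hα
      | add a b ha hb => rw [add_smul, map_add, map_add, add_smul, ha, hb]
    induction m using h.induction_on with
    | homogeneous γ m hm =>
      rw [← key a γ m hm]
      exact hN' γ _ (hsmul (Submodule.smul_mem_pointwise_smul _ _ _ trivial))
    | add m m' hm hm' => rw [smul_add]; exact add_mem hm hm'

end GradedModules

/-! ### Stable retractions, minimal generators and the syzygy step. -/

section Syzygies

variable {S G : Type*} [CommRing S] [AddCommGroup G] {n : ℕ} {deg : Fin n → G}
variable {N Y : Type*} [AddCommGroup N] [Module (MvPolynomial (Fin n) S) N]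
  [AddCommGroup Y] [Module (MvPolynomial (Fin n) S) Y]

/-- `N` is a direct summand of `Y`, up to multiplication by an element of `(X_1, …, X_n)` and up to
maps which factor through free modules. -/
structure StableRetract (𝒩 : G → AddSubgroup N) (𝒴 : G → AddSubgroup Y) where
  α : N →ₗ[MvPolynomial (Fin n) S] Y
  β : Y →ₗ[MvPolynomial (Fin n) S] N
  a : MvPolynomial (Fin n) S
  rank : ℕ
  toFree : N →ₗ[MvPolynomial (Fin n) S] (Fin rank →₀ MvPolynomial (Fin n) S)
  ofFree : (Fin rank →₀ MvPolynomial (Fin n) S) →ₗ[MvPolynomial (Fin n) S] N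
  α_mem : ∀ γ, ∀ m ∈ 𝒩 γ, α m ∈ 𝒴 γ
  a_mem : a ∈ irrelevant S n
  β_α : ∀ m, β (α m) = m + a • m + ofFree (toFree m)

/-- The identity as a stable retraction. -/
def StableRetract.refl (𝒩 : G → AddSubgroup N) : StableRetract (S := S) (n := n) 𝒩 𝒩 where
  α := LinearMap.id
  β := LinearMap.id
  a := 0
  rank := 0
  toFree := 0
  ofFree := 0
  α_mem _ _ hm := hm
  a_mem := zero_mem _
  β_α m := by simp

/-- Restriction of a stable retraction to a submodule containing `u N`, with `u ∈ 1 + (X)`. -/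
def StableRetract.restrict {𝒩 : G → AddSubgroup N} {𝒴 : G → AddSubgroup Y}
    (h : StableRetract (S := S) (n := n) 𝒩 𝒴) (N' : Submodule (MvPolynomial (Fin n) S) N)
    {u : MvPolynomial (Fin n) S} (hu : u - 1 ∈ irrelevant S n) (huN : ∀ m : N, u • m ∈ N') :
    StableRetract (S := S) (n := n) (subPiece 𝒩 N') 𝒴 where
  α := h.α ∘ₗ N'.subtype
  β := (LinearMap.codRestrict N' (u • LinearMap.id) huN) ∘ₗ h.β
  a := u - 1 + u * h.a
  rank := h.rank
  toFree := h.toFree ∘ₗ N'.subtype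
  ofFree := (LinearMap.codRestrict N' (u • LinearMap.id) huN) ∘ₗ h.ofFree
  α_mem γ m hm := h.α_mem γ m hm
  a_mem := add_mem hu (Ideal.mul_mem_left _ _ h.a_mem)
  β_α m := by
    ext
    simp only [LinearMap.comp_apply, LinearMap.codRestrict_apply, LinearMap.smul_apply,
      LinearMap.id_apply, Submodule.subtype_apply, h.β_α, Submodule.coe_add, Submodule.coe_smul]
    module

/-- For the kernel `K` of a graded surjection from a free module `F`, the vanishing of
`Tor_1(F / K, S)_γ = ((K ∩ (X) F) / (X) K)_γ`. -/
def TorOneVanishes {F : Type*} [AddCommGroup F] [Module (MvPolynomial (Fin n) S) F]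
    (ℱ : G → AddSubgroup F) (K : Submodule (MvPolynomial (Fin n) S) F) (γ : G) : Prop :=
  ∀ x : K, (x : F) ∈ ℱ γ →
    (x : F) ∈ irrelevant S n • (⊤ : Submodule (MvPolynomial (Fin n) S) F) →
    x ∈ irrelevant S n • (⊤ : Submodule (MvPolynomial (Fin n) S) K)

/-- The maps between the first syzygies induced by a stable retraction. -/
theorem StableRetract.exists_lift {𝒩 : G → AddSubgroup N} {𝒴 : G → AddSubgroup Y}
    (h : StableRetract (S := S) (n := n) 𝒩 𝒴)
    {s : ℕ} {e : Fin s → G} {φ : (Fin s →₀ MvPolynomial (Fin n) S) →ₗ[MvPolynomial (Fin n) S] N}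
    (hφ : Function.Surjective φ) (hφg : ∀ γ, ∀ x ∈ freePiece deg e γ, φ x ∈ 𝒩 γ)
    {ι : Type*} {e' : ι → G} {ψ : (ι →₀ MvPolynomial (Fin n) S) →ₗ[MvPolynomial (Fin n) S] Y}
    (hψg : ∀ γ, ∀ y ∈ 𝒴 γ, ∃ x ∈ freePiece deg e' γ, ψ x = y) :
    ∃ (α' : (Fin s →₀ MvPolynomial (Fin n) S) →ₗ[MvPolynomial (Fin n) S]
        (ι →₀ MvPolynomial (Fin n) S))
      (β' : (ι →₀ MvPolynomial (Fin n) S) →ₗ[MvPolynomial (Fin n) S]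
        (Fin s →₀ MvPolynomial (Fin n) S))
      (t : (Fin s →₀ MvPolynomial (Fin n) S) →ₗ[MvPolynomial (Fin n) S]
        (Fin s →₀ MvPolynomial (Fin n) S)),
      (∀ γ, ∀ x ∈ freePiece deg e γ, α' x ∈ freePiece deg e' γ) ∧
      (∀ x ∈ LinearMap.ker φ, α' x ∈ LinearMap.ker ψ) ∧
      (∀ x ∈ LinearMap.ker ψ, β' x ∈ LinearMap.ker φ) ∧
      (∀ x, t x ∈ LinearMap.ker φ) ∧
      ∀ x ∈ LinearMap.ker φ, β' (α' x) = x + h.a • x + t x := by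
  -- The lift of `α` must preserve degrees, so basis elements are lifted homogeneously; for `β'` and
  -- `v'` projectivity suffices.
  have hw : ∀ k, ∃ x ∈ freePiece deg e' (e k), ψ x = h.α (φ (Finsupp.single k 1)) := fun k =>
    hψg _ _ (h.α_mem _ _ (hφg _ _ (single_one_mem_freePiece e k)))
  choose w hw hwψ using hw
  have hα' : ∀ x, ψ (Finsupp.linearCombination _ w x) = h.α (φ x) := by
    intro x
    have : ψ ∘ₗ Finsupp.linearCombination _ w = h.α ∘ₗ φ := by
      refine Finsupp.lhom_ext' fun k => LinearMap.ext_ring ?_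
      simp only [LinearMap.comp_apply, Finsupp.lsingle_apply, Finsupp.linearCombination_single,
        one_smul, hwψ]
    exact LinearMap.congr_fun this x
  obtain ⟨β', hβ'⟩ := Module.projective_lifting_property φ (h.β ∘ₗ ψ) hφ
  obtain ⟨v', hv'⟩ := Module.projective_lifting_property φ h.ofFree hφ
  have hβ'x : ∀ x, φ (β' x) = h.β (ψ x) := LinearMap.congr_fun hβ'
  have hv'x : ∀ x, φ (v' x) = h.ofFree x := LinearMap.congr_fun hv'
  -- `t` is the defect of `β' ∘ α'`. It is defined on the whole free module with values in `ker φ`,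
  -- so its restriction to `ker φ` factors through a free module. Its last term is zero on `ker φ`.
  refine ⟨Finsupp.linearCombination _ w, β', β' ∘ₗ Finsupp.linearCombination _ w - LinearMap.id -
    h.a • LinearMap.id - v' ∘ₗ h.toFree ∘ₗ φ, fun γ x hx =>
      linearCombination_mem (GradedProjections.free (S := S) deg e') hw hx, fun x hx => ?_,
      fun x hx => ?_, fun x => ?_, fun x hx => ?_⟩
  · rw [LinearMap.mem_ker] at hx ⊢
    rw [hα', hx, map_zero]
  · rw [LinearMap.mem_ker] at hx ⊢
    rw [hβ'x, hx, map_zero]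
  · rw [LinearMap.mem_ker]
    simp only [LinearMap.sub_apply, LinearMap.comp_apply, LinearMap.smul_apply,
      LinearMap.id_apply, map_sub, map_smul, hβ'x, hv'x, hα', h.β_α]
    abel
  · rw [LinearMap.mem_ker] at hx
    simp only [LinearMap.sub_apply, LinearMap.comp_apply, LinearMap.smul_apply,
      LinearMap.id_apply, hx, map_zero]
    abel

-- Solving `β_α` for `m` leaves three terms, each in `(X) N`; this is how the retraction detects
-- membership in `(X) N`.
omit [AddCommGroup G] in
theorem StableRetract.mem_smul_top {𝒩 : G → AddSubgroup N} {𝒴 : G → AddSubgroup Y}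
    (h : StableRetract (S := S) (n := n) 𝒩 𝒴) {m : N}
    (hα : h.α m ∈ irrelevant S n • (⊤ : Submodule (MvPolynomial (Fin n) S) Y))
    (hu : h.toFree m ∈ irrelevant S n •
      (⊤ : Submodule (MvPolynomial (Fin n) S) (Fin h.rank →₀ MvPolynomial (Fin n) S))) :
    m ∈ irrelevant S n • (⊤ : Submodule (MvPolynomial (Fin n) S) N) := by
  have hm : m = h.β (h.α m) - h.ofFree (h.toFree m) - h.a • m := by
    rw [h.β_α, add_sub_cancel_right, add_sub_cancel_right]
  rw [hm]
  exact sub_mem (sub_mem (map_mem_smul_top h.β hα) (map_mem_smul_top h.ofFree hu))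
    (Submodule.smul_mem_smul h.a_mem trivial)

/-- A stable retraction lifts to the first syzygies, and preserves the vanishing of `Tor_1`. -/
theorem StableRetract.exists_syzygy {𝒩 : G → AddSubgroup N} {𝒴 : G → AddSubgroup Y}
    (h : StableRetract (S := S) (n := n) 𝒩 𝒴)
    {s : ℕ} {e : Fin s → G} {φ : (Fin s →₀ MvPolynomial (Fin n) S) →ₗ[MvPolynomial (Fin n) S] N}
    (hφ : Function.Surjective φ) (hφg : ∀ γ, ∀ x ∈ freePiece deg e γ, φ x ∈ 𝒩 γ)
    {ι : Type*} {e' : ι → G} {ψ : (ι →₀ MvPolynomial (Fin n) S) →ₗ[MvPolynomial (Fin n) S] Y}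
    (hψg : ∀ γ, ∀ y ∈ 𝒴 γ, ∃ x ∈ freePiece deg e' γ, ψ x = y) :
    Nonempty (StableRetract (S := S) (n := n) (subPiece (freePiece deg e) (LinearMap.ker φ))
      (subPiece (freePiece deg e') (LinearMap.ker ψ))) ∧
    ∀ γ, TorOneVanishes (S := S) (freePiece deg e') (LinearMap.ker ψ) γ →
      TorOneVanishes (S := S) (freePiece deg e) (LinearMap.ker φ) γ := by
  obtain ⟨α', β', t, hα'g, hαK, hβK, ht, hβα'⟩ := h.exists_lift hφ hφg hψg
  obtain ⟨αK, hα⟩ : ∃ αK : LinearMap.ker φ →ₗ[MvPolynomial (Fin n) S] LinearMap.ker ψ,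
      ∀ z, (αK z : ι →₀ MvPolynomial (Fin n) S) = α' z := ⟨LinearMap.restrict α' hαK, fun _ => rfl⟩
  obtain ⟨βK, hβ⟩ : ∃ βK : LinearMap.ker ψ →ₗ[MvPolynomial (Fin n) S] LinearMap.ker φ,
      ∀ z, (βK z : Fin s →₀ MvPolynomial (Fin n) S) = β' z :=
    ⟨LinearMap.restrict β' hβK, fun _ => rfl⟩
  obtain ⟨tK, htK⟩ : ∃ tK : (Fin s →₀ MvPolynomial (Fin n) S) →ₗ[MvPolynomial (Fin n) S]
      LinearMap.ker φ, ∀ z, (tK z : Fin s →₀ MvPolynomial (Fin n) S) = t z :=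
    ⟨LinearMap.codRestrict _ t ht, fun _ => rfl⟩
  have hβα : ∀ z : LinearMap.ker φ,
      βK (αK z) = z + h.a • z + tK ((LinearMap.ker φ).subtype z) := by
    intro z
    apply Subtype.ext
    rw [hβ, hα, hβα' z z.2, Submodule.coe_add, Submodule.coe_add, htK, Submodule.coe_smul,
      Submodule.subtype_apply]
  have hαg : ∀ γ, ∀ z ∈ subPiece (freePiece deg e) (LinearMap.ker φ) γ,
      αK z ∈ subPiece (freePiece deg e') (LinearMap.ker ψ) γ := by
    intro γ z hz
    rw [mem_subPiece] at hz ⊢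
    rw [hα]
    exact hα'g γ z hz
  -- The free module in the new retraction is the cover itself, with `toFree` the inclusion of `ker
  -- φ`. So the condition `z ∈ (X) F` in `TorOneVanishes` is the one that `mem_smul_top` asks of
  -- `toFree z`.
  let R : StableRetract (S := S) (n := n) (subPiece (freePiece deg e) (LinearMap.ker φ))
      (subPiece (freePiece deg e') (LinearMap.ker ψ)) :=
    ⟨αK, βK, h.a, s, (LinearMap.ker φ).subtype, tK, hαg, h.a_mem, hβα⟩
  refine ⟨⟨R⟩, fun γ hγ z hz hzX => R.mem_smul_top (hγ (αK z) (hαg γ z hz) ?_) hzX⟩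
  rw [hα]
  exact map_mem_smul_top α' hzX

/-- A family of homogeneous elements which generates `N` modulo `(X_1, …, X_n) N`. -/
structure GeneratesModulo (𝒩 : G → AddSubgroup N) {s : ℕ} (e : Fin s → G) (v : Fin s → N) :
    Prop where
  mem : ∀ k, v k ∈ 𝒩 (e k)
  le : (⊤ : Submodule (MvPolynomial (Fin n) S) N) ≤ Submodule.span _ (Set.range v) ⊔
    irrelevant S n • (⊤ : Submodule (MvPolynomial (Fin n) S) N)

theorem GradedProjections.exists_generatesModulo {𝒩 : G → AddSubgroup N}
    (h : GradedProjections (S := S) deg 𝒩) [Module.Finite (MvPolynomial (Fin n) S) N] :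
    ∃ (s : ℕ) (e : Fin s → G) (v : Fin s → N), GeneratesModulo (S := S) (n := n) 𝒩 e v := by
  classical
  obtain ⟨T, hT⟩ := Module.Finite.fg_top (R := MvPolynomial (Fin n) S) (M := N)
  choose c hc using h.exists_sum
  let A : Finset (G × N) := T.biUnion fun m => (c m).image fun γ => (γ, m)
  refine ⟨A.card, fun k => (A.equivFin.symm k).1.1,
    fun k => h.proj (A.equivFin.symm k).1.1 (A.equivFin.symm k).1.2, fun k => h.proj_mem _ _, ?_⟩
  refine le_sup_of_le_left ?_
  rw [← hT, Submodule.span_le]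
  intro m hm
  rw [SetLike.mem_coe, ← hc m]
  refine sum_mem fun γ hγ => Submodule.subset_span ?_
  have hA : (γ, m) ∈ A := Finset.mem_biUnion.2 ⟨m, hm, Finset.mem_image.2 ⟨γ, hγ, rfl⟩⟩
  exact ⟨A.equivFin ⟨_, hA⟩, by simp⟩

/-- A graded module has a minimal family of homogeneous generators modulo `(X_1, …, X_n)`. -/
theorem GradedProjections.exists_minimal_generatesModulo {𝒩 : G → AddSubgroup N}
    (h : GradedProjections (S := S) deg 𝒩) [Module.Finite (MvPolynomial (Fin n) S) N] :
    ∃ (s : ℕ) (e : Fin s → G) (v : Fin s → N), GeneratesModulo (S := S) (n := n) 𝒩 e v ∧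
      ∀ k, v k ∉ Submodule.span (MvPolynomial (Fin n) S) (v '' {k}ᶜ) ⊔
        irrelevant S n • (⊤ : Submodule (MvPolynomial (Fin n) S) N) := by
  classical
  -- Take the least possible number of generators; a redundant `v k` could be dropped.
  have hex := h.exists_generatesModulo
  obtain ⟨e, v, hv⟩ := Nat.find_spec hex
  refine ⟨_, e, v, hv, fun k hk => ?_⟩
  have hmin := fun t => Nat.find_min (m := t) hex
  generalize Nat.find hex = s at e v k hmin
  obtain ⟨t, rfl⟩ : ∃ t, s = t + 1 := ⟨s - 1, by have := k.2; omega⟩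
  refine hmin t (Nat.lt_succ_self t) ⟨e ∘ k.succAbove, v ∘ k.succAbove, fun i => hv.mem _, ?_⟩
  have hr : Set.range (v ∘ k.succAbove) = v '' {k}ᶜ := by
    rw [Set.range_comp, Fin.range_succAbove]
  rw [hr]
  refine hv.le.trans (sup_le (Submodule.span_le.2 ?_) le_sup_right)
  rintro _ ⟨i, rfl⟩
  by_cases hi : i = k
  · exact hi ▸ hk
  · exact Submodule.mem_sup_left (Submodule.subset_span ⟨i, hi, rfl⟩)

/-- Over a field, the relations of a minimal family of generators have coefficients in
`(X_1, …, X_n)`. -/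
theorem mem_irrelevant_of_minimal (hS : IsField S) {s : ℕ} {v : Fin s → N}
    (hmin : ∀ k, v k ∉ Submodule.span (MvPolynomial (Fin n) S) (v '' {k}ᶜ) ⊔
        irrelevant S n • (⊤ : Submodule (MvPolynomial (Fin n) S) N))
    {z : Fin s →₀ MvPolynomial (Fin n) S} (hz : Finsupp.linearCombination _ v z = 0) (k : Fin s) :
    z k ∈ irrelevant S n := by
  classical
  rw [mem_irrelevant_iff]
  by_contra hc
  obtain ⟨b, hb⟩ := hS.mul_inv_cancel hc
  set c := MvPolynomial.coeff 0 (z k) with hcdef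
  refine hmin k ?_
  have hsum : z k • v k + ∑ i ∈ Finset.univ.erase k, z i • v i = 0 := by
    rw [Finset.add_sum_erase Finset.univ (fun i => (z i • v i : N)) (Finset.mem_univ k),
      ← hz, Finsupp.linearCombination_apply, Finsupp.sum_fintype _ _ (by simp)]
  have h1 : z k - MvPolynomial.C c ∈ irrelevant S n := by
    rw [mem_irrelevant_iff]; simp [hcdef]
  -- Solve the relation for `v k`: its coefficient is the invertible constant `c` modulo `(X)`.
  have h2 : v k = (MvPolynomial.C b : MvPolynomial (Fin n) S) •
      (-(∑ i ∈ Finset.univ.erase k, z i • v i)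
      - (z k - MvPolynomial.C c) • v k) := by
    rw [← eq_neg_of_add_eq_zero_left hsum, sub_smul (z k), sub_sub_cancel, smul_smul,
      ← MvPolynomial.C_mul, mul_comm, hb, MvPolynomial.C_1, one_smul]
  rw [h2]
  refine Submodule.smul_mem _ _ (sub_mem (neg_mem ?_) ?_)
  · refine Submodule.mem_sup_left (sum_mem fun i hi => Submodule.smul_mem _ _
      (Submodule.subset_span ⟨i, ?_, rfl⟩))
    exact Finset.ne_of_mem_erase hi
  · exact Submodule.mem_sup_right (Submodule.smul_mem_smul h1 trivial)

/-- The identity is the sum of the coordinate projections followed by the inclusions, and the `k`-th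
projection shifts degrees by `-e k`. -/
theorem cechAcyclic_free {r : ℕ} {f : Fin r → MvPolynomial (Fin n) S} {δ : Fin r → G}
    (hf : ∀ j, f j ∈ polyPiece deg S (δ j)) {s : ℕ} {e : Fin s → G} {p : ℕ} {γ : G}
    (h : ∀ k, CechAcyclic f δ (polyPiece deg S) p (γ - e k)) :
    CechAcyclic f δ (freePiece (S := S) deg e) p γ := by
  classical
  refine CechAcyclic.of_sum ((GradedProjections.free (S := S) deg e).cechProjections hf).compatible
    (ℳ := polyPiece deg S) (μ := fun k => Finsupp.lapply k) (ι := fun k => Finsupp.lsingle k)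
    (s := fun k => - e k) (fun k γ x hx => ?_) ?_ fun k => ?_
  · rw [← sub_eq_add_neg]; exact hx k
  · ext k : 2
    simp [Finsupp.single_apply]
    rw [Finset.sum_eq_single k]
    · simp
    · intro i _ hi
      simp [hi.symm]
    · simp
  · rw [← sub_eq_add_neg]; exact h k

/-- One step in the construction of a resolution of a finitely generated graded module by free
modules with few generators, up to elements of `1 + (X_1, …, X_n)`. -/
theorem exists_syzygy_step {r : ℕ} {f : Fin r → MvPolynomial (Fin n) S} {δ : Fin r → G}
    (hf : ∀ j, f j ∈ polyPiece deg S (δ j))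
    (hdeg : ∀ a : Fin n →₀ ℕ, a ≠ 0 → Finsupp.weight deg a = 0 →
      MvPolynomial.monomial a (1 : S) ∈ (Ideal.span (Set.range f)).radical)
    [Module.Finite (MvPolynomial (Fin n) S) N] {𝒩 : G → AddSubgroup N} {𝒴 : G → AddSubgroup Y}
    (h𝒩 : GradedProjections (S := S) deg 𝒩) (hR : StableRetract (S := S) (n := n) 𝒩 𝒴)
    {ι : Type*} {e' : ι → G} {ψ : (ι →₀ MvPolynomial (Fin n) S) →ₗ[MvPolynomial (Fin n) S] Y}
    (hψg : ∀ γ, ∀ y ∈ 𝒴 γ, ∃ x ∈ freePiece deg e' γ, ψ x = y)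
    {A : Set G} (hA : ∀ γ ∉ A, ∀ m ∈ 𝒩 γ,
      m ∈ irrelevant S n • (⊤ : Submodule (MvPolynomial (Fin n) S) N)) :
    ∃ (s : ℕ) (e : Fin s → G) (Z : Submodule (MvPolynomial (Fin n) S)
        (Fin s →₀ MvPolynomial (Fin n) S)),
      (∀ k, e k ∈ A) ∧ Nonempty (GradedProjections (S := S) deg (subPiece (freePiece deg e) Z)) ∧
      Nonempty (StableRetract (S := S) (n := n) (subPiece (freePiece deg e) Z)
        (subPiece (freePiece deg e') (LinearMap.ker ψ))) ∧
      (∀ γ, TorOneVanishes (S := S) (freePiece deg e') (LinearMap.ker ψ) γ → (γ ∉ A ∨ IsField S) →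
        ∀ z ∈ subPiece (freePiece deg e) Z γ,
          z ∈ irrelevant S n • (⊤ : Submodule (MvPolynomial (Fin n) S) Z)) ∧
      ∀ p γ, (∀ k, CechAcyclic f δ (polyPiece deg S) p (γ - e k)) →
        CechAcyclic f δ (subPiece (freePiece deg e) Z) (p + 1) γ → CechAcyclic f δ 𝒩 p γ := by
  obtain ⟨s, e, v, hv, hmin⟩ := h𝒩.exists_minimal_generatesModulo
  have hP := GradedProjections.free (S := S) deg e
  let φ : (Fin s →₀ MvPolynomial (Fin n) S) →ₗ[MvPolynomial (Fin n) S] N :=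
    Finsupp.linearCombination _ v
  have hφ : ∀ γ, ∀ x ∈ freePiece deg e γ, φ x ∈ 𝒩 γ := fun γ x hx =>
    linearCombination_mem h𝒩 hv.mem hx
  have heA : ∀ k, e k ∈ A := by
    intro k
    by_contra hk
    -- A generator of degree outside `A` would lie in `(X) N` and be redundant.
    exact hmin k (Submodule.mem_sup_right (hA _ hk _ (hv.mem k)))
  have hφproj : ∀ γ x, φ (hP.proj γ x) = h𝒩.proj γ (φ x) :=
    hP.map_proj h𝒩 (φ := φ.toAddMonoidHom) hφ
  let N' := LinearMap.range φ
  have hN' : ∀ γ, ∀ m ∈ N', h𝒩.proj γ m ∈ N' := by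
    rintro γ _ ⟨x, rfl⟩
    exact ⟨hP.proj γ x, hφproj γ x⟩
  obtain ⟨u, hu0, hu1, huN⟩ := h𝒩.exists_degree_zero_smul_mem hN'
    (by simpa only [N', φ, Finsupp.range_linearCombination] using hv.le)
  let φ' := φ.rangeRestrict
  have hφ' : Function.Surjective φ' := LinearMap.surjective_rangeRestrict φ
  have hφ'g : ∀ γ, ∀ x ∈ freePiece deg e γ, φ' x ∈ subPiece 𝒩 N' γ := hφ
  have h𝒩' := h𝒩.sub N' hN'
  have hZ : ∀ γ, ∀ z ∈ LinearMap.ker φ', hP.proj γ z ∈ LinearMap.ker φ' := by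
    intro γ z hz
    rw [LinearMap.ker_rangeRestrict, LinearMap.mem_ker] at hz ⊢
    rw [hφproj, hz, map_zero]
  have h𝒵 := hP.sub _ hZ
  obtain ⟨hR', hTor⟩ := (hR.restrict N' hu1 huN).exists_syzygy hφ' hφ'g hψg
  refine ⟨s, e, LinearMap.ker φ', heA, ⟨h𝒵⟩, hR', fun γ hγ hγA z hz => ?_, fun p γ hp hZp => ?_⟩
  · refine hTor γ hγ z hz (mem_smul_top_of_forall_mem fun k => ?_)
    -- The `k`-th coordinate of `z` has degree `γ - e k`, nonzero if `γ ∉ A` because `e k ∈ A`. Over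
    -- a field, minimality puts every coordinate in `(X)`.
    rcases hγA with hγA | hS
    · exact mem_irrelevant_of_mem_polyPiece (hz k)
        (sub_ne_zero.2 fun h => hγA (h ▸ heA k))
    · refine mem_irrelevant_of_minimal hS hmin ?_ k
      exact congrArg Subtype.val (LinearMap.mem_ker.1 z.2)
  · have hacN' : CechAcyclic f δ (subPiece 𝒩 N') p γ := by
      refine CechAcyclic.of_exact_right (h𝒵.cechProjections hf) (hP.cechProjections hf).compatible
        (h𝒩'.cechProjections hf).compatible (ι := (LinearMap.ker φ').subtype) (π := φ')
        Subtype.val_injective (fun _ _ hl => hl) ?_ ?_ ?_ (cechAcyclic_free hf hp) hZp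
      · intro γ m hm
        obtain ⟨x, rfl⟩ := hφ' m
        exact hP.exists_homogeneous_preimage h𝒩' hφ'g hm
      · exact fun γ m hm h0 => ⟨⟨m, h0⟩, hm, rfl⟩
      · ext x; simp
    -- Pass from `N'` to `N`: multiplication by `u` factors through `N'`, and `u - 1` lies in the
    -- radical of `(f_j)`.
    refine CechAcyclic.of_factor (h𝒩.cechProjections hf).compatible
      (μ := LinearMap.codRestrict N' (u • LinearMap.id) huN) (ι := N'.subtype) ?_ (u := u) ?_ rfl
      hacN'
    · intro γ m hm
      have := h𝒩.smul_mem hu0 hm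
      rw [zero_add] at this
      exact this
    · exact mem_of_mem_polyPiece_zero (sub_mem hu0 one_mem_polyPiece) hu1 hdeg

end Syzygies

/-! ### From the given resolution to the vanishing of local cohomology of `M`. -/

section TorSupport

theorem tmul_one_eq_zero_iff {R M : Type*} [CommRing R] [AddCommGroup M] [Module R M]
    (I : Ideal R) (x : M) :
    x ⊗ₜ[R] (1 : R ⧸ I) = 0 ↔ x ∈ I • (⊤ : Submodule R M) := by
  rw [← (TensorProduct.tensorQuotEquivQuotSMul M I).map_eq_zero_iff,
    ← map_one (Ideal.Quotient.mk I), TensorProduct.tensorQuotEquivQuotSMul_tmul_mk, one_smul,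
    Submodule.Quotient.mk_eq_zero]

theorem exists_tmul_one_eq {R M : Type*} [CommRing R] [AddCommGroup M] [Module R M]
    (I : Ideal R) (w : M ⊗[R] (R ⧸ I)) : ∃ y : M, y ⊗ₜ[R] (1 : R ⧸ I) = w := by
  obtain ⟨y, hy⟩ := Submodule.Quotient.mk_surjective _ (TensorProduct.tensorQuotEquivQuotSMul M I w)
  refine ⟨y, (TensorProduct.tensorQuotEquivQuotSMul M I).injective ?_⟩
  rw [← hy, ← map_one (Ideal.Quotient.mk I), TensorProduct.tensorQuotEquivQuotSMul_tmul_mk,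
    one_smul]

variable {S G : Type*} [CommRing S] [AddCommGroup G] {n : ℕ} {deg : Fin n → G}
variable {M : Type*} [AddCommGroup M] [Module (MvPolynomial (Fin n) S) M]
  {ℳ : G → AddSubgroup M}

namespace GradedFreeResolution

variable (F : GradedFreeResolution (S := S) deg ℳ)

/-- Vanishing of `Tor_i` in degree `γ`, lifted from `F ⊗ S` to `F`: every element of `F_i ⊗ S` has
the form `y ⊗ 1`, and `x ⊗ 1 = 0` means `x ∈ (X) F_i`. -/
theorem exists_sub_mem_of_notMem_torSupport {i : ℕ} {γ : G} (hγ : γ ∉ F.torSupport i)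
    {x : F.ι i →₀ MvPolynomial (Fin n) S} (hx : x ∈ freePiece deg (F.shift i) γ)
    (hc : (x ⊗ₜ 1 : F.tensorTerm i) ∈ F.tensorCycle i) :
    ∃ y, x - F.d i y ∈ irrelevant S n •
      (⊤ : Submodule (MvPolynomial (Fin n) S) (F.ι i →₀ MvPolynomial (Fin n) S)) := by
  rw [torSupport, notMem_gradedSupport_homologyPiece_iff] at hγ
  obtain ⟨w, hw⟩ := hγ _ hc ⟨x, hx, rfl⟩
  obtain ⟨y, rfl⟩ := exists_tmul_one_eq _ w
  refine ⟨y, ?_⟩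
  rw [← tmul_one_eq_zero_iff, TensorProduct.sub_tmul, sub_eq_zero]
  exact hw.symm

theorem mem_smul_top_of_notMem_torSupport {ℱ : GradedProjections (S := S) deg ℳ} {γ : G}
    (hγ : γ ∉ F.torSupport 0) {m : M} (hm : m ∈ ℳ γ) :
    m ∈ irrelevant S n • (⊤ : Submodule (MvPolynomial (Fin n) S) M) := by
  obtain ⟨x, rfl⟩ := F.ε_surjective m
  obtain ⟨x, hx, hxm⟩ := (GradedProjections.free (S := S) deg
    (F.shift 0)).exists_homogeneous_preimage
    ℱ F.ε_mem hm
  obtain ⟨y, hy⟩ := F.exists_sub_mem_of_notMem_torSupport hγ hx trivial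
  have h := map_mem_smul_top F.ε hy
  rwa [map_sub, (F.exact_zero _).2 ⟨y, rfl⟩, sub_zero, hxm] at h

/-- Dimension shifting: `Tor_{i+1}(M, S)` is `Tor_1` of the cokernel of `d i`. A preimage of an
element of `(X) F_i` under `d i` is a cycle modulo `(X)`. -/
theorem torOneVanishes_of_notMem_torSupport {i : ℕ} {γ : G} (hγ : γ ∉ F.torSupport (i + 1)) :
    TorOneVanishes (S := S) (freePiece deg (F.shift i)) (LinearMap.range (F.d i)) γ := by
  rintro ⟨_, x, rfl⟩ hz hzX
  obtain ⟨x, hx, hxz⟩ := (GradedProjections.free (S := S) deg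
    (F.shift (i + 1))).exists_homogeneous_preimage
    (GradedProjections.free (S := S) deg (F.shift i)) (F.d_mem i) hz
  obtain ⟨y, hy⟩ := F.exists_sub_mem_of_notMem_torSupport hγ hx (by
    change F.tensorD i (x ⊗ₜ 1) = 0
    rw [tensorD, LinearMap.rTensor_tmul, tmul_one_eq_zero_iff, hxz]
    exact hzX)
  have h := map_mem_smul_top (N := LinearMap.range (F.d i)) (F.d i).rangeRestrict hy
  convert h using 1
  refine Subtype.ext ?_
  change F.d i _ = F.d i (x - F.d (i + 1) y)
  rw [map_sub, (F.exact_succ i _).2 ⟨y, rfl⟩, sub_zero, hxz]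

theorem ker_ε : LinearMap.ker F.ε = LinearMap.range (F.d 0) :=
  F.exact_zero.linearMap_ker_eq

theorem ker_rangeRestrict_d (i : ℕ) :
    LinearMap.ker (F.d i).rangeRestrict = LinearMap.range (F.d (i + 1)) := by
  rw [LinearMap.ker_rangeRestrict, (F.exact_succ i).linearMap_ker_eq]

variable {r : ℕ} {f : Fin r → MvPolynomial (Fin n) S} {δ : Fin r → G}

/-- Vanishing of local cohomology for the syzygies of the resolution constructed step by step from
minimal generators. -/
theorem cechAcyclic_syzygy [IsNoetherianRing S] (hf : ∀ j, f j ∈ polyPiece deg S (δ j))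
    (hdeg : ∀ a : Fin n →₀ ℕ, a ≠ 0 → Finsupp.weight deg a = 0 →
      MvPolynomial.monomial a (1 : S) ∈ (Ideal.span (Set.range f)).radical)
    {A : ℕ → Set G} (hA : ∀ k, F.torSupport k ⊆ A k)
    (hA' : (∀ k, A k ⊆ A (k + 1)) ∨ IsField S) (t : ℕ) :
    ∀ (i k s : ℕ) (e : Fin s → G)
      (Z : Submodule (MvPolynomial (Fin n) S) (Fin s →₀ MvPolynomial (Fin n) S)),
      r < i + t → GradedProjections (S := S) deg (subPiece (freePiece deg e) Z) →
      StableRetract (S := S) (n := n) (subPiece (freePiece deg e) Z)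
        (subPiece (freePiece deg (F.shift k)) (LinearMap.range (F.d k))) →
      (∀ γ ∉ A (k + 1), ∀ z ∈ subPiece (freePiece deg e) Z γ,
        z ∈ irrelevant S n • (⊤ : Submodule (MvPolynomial (Fin n) S) Z)) →
      ∀ γ, (∀ q, ∀ τ ∈ A (k + 1 + q), CechAcyclic f δ (polyPiece deg S) (i + q) (γ - τ)) →
        CechAcyclic f δ (subPiece (freePiece deg e) Z) i γ := by
  -- `t` bounds the remaining steps: each one raises `i` and lowers `t`, so at `t = 0` the
  -- cohomological degree exceeds the length of the Čech complex.
  induction t with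
  | zero => exact fun i k s e Z hi _ _ _ γ _ => CechAcyclic.of_lt hi _ γ
  | succ t ih =>
    intro i k s e Z hi hZ hR hτ γ hac
    have hfree := GradedProjections.free (S := S) deg (F.shift (k + 1))
    obtain ⟨s', e', Z', he', ⟨hZ'⟩, hR', hτ', hstep⟩ := exists_syzygy_step hf hdeg hZ hR
      (ψ := (F.d k).rangeRestrict) (e' := F.shift (k + 1)) (by
        rintro γ ⟨_, x, rfl⟩ hx
        obtain ⟨x', hx', h⟩ := hfree.exists_homogeneous_preimage
          (GradedProjections.free (S := S) deg (F.shift k)) (F.d_mem k) hx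
        exact ⟨x', hx', Subtype.ext h⟩) hτ
    rw [F.ker_rangeRestrict_d] at hR' hτ'
    obtain ⟨hR'⟩ := hR'
    refine hstep i γ (fun l => by simpa using hac 0 (e' l) (he' l)) ?_
    refine ih (i + 1) (k + 1) s' e' Z' (by omega) hZ' hR' (fun γ hγ => ?_) γ fun q τ hτA => ?_
    · refine hτ' γ (F.torOneVanishes_of_notMem_torSupport fun h => hγ (hA _ h)) ?_
      -- If the sets increase, `γ ∉ A (k + 2)` gives `γ ∉ A (k + 1)`, where the degrees of the
      -- current generators lie.
      exact hA'.imp_left fun h h' => hγ (h _ h')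
    · rw [add_assoc i, add_comm 1]
      exact hac (q + 1) τ (by rwa [add_comm q, ← add_assoc])

/-- The vanishing of local cohomology of `M` in terms of that of `R` and of `Tor^R(M, S)`. -/
theorem cechAcyclic_of_poly [IsNoetherianRing S] [Module.Finite (MvPolynomial (Fin n) S) M]
    (hℳ : GradedProjections (S := S) deg ℳ) (hf : ∀ j, f j ∈ polyPiece deg S (δ j))
    (hdeg : ∀ a : Fin n →₀ ℕ, a ≠ 0 → Finsupp.weight deg a = 0 →
      MvPolynomial.monomial a (1 : S) ∈ (Ideal.span (Set.range f)).radical)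
    {A : ℕ → Set G} (hA : ∀ k, F.torSupport k ⊆ A k)
    (hA' : (∀ k, A k ⊆ A (k + 1)) ∨ IsField S) {i : ℕ} {γ : G}
    (hac : ∀ q, ∀ τ ∈ A q, CechAcyclic f δ (polyPiece deg S) (i + q) (γ - τ)) :
    CechAcyclic f δ ℳ i γ := by
  obtain ⟨s', e', Z', he', ⟨hZ'⟩, hR', hτ', hstep⟩ := exists_syzygy_step (A := A 0) hf hdeg hℳ
    (StableRetract.refl ℳ) (ψ := F.ε) (e' := F.shift 0) (by
      intro γ m hm
      obtain ⟨x, rfl⟩ := F.ε_surjective m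
      exact (GradedProjections.free (S := S) deg (F.shift 0)).exists_homogeneous_preimage
        hℳ F.ε_mem hm)
    (fun γ hγ m hm => F.mem_smul_top_of_notMem_torSupport (ℱ := hℳ) (fun h => hγ (hA _ h)) hm)
  rw [F.ker_ε] at hR' hτ'
  obtain ⟨hR'⟩ := hR'
  refine hstep i γ (fun l => by simpa using hac 0 (e' l) (he' l)) ?_
  refine F.cechAcyclic_syzygy hf hdeg hA hA' (r + 1) (i + 1) 0 s' e' Z' (by omega) hZ' hR'
    (fun γ hγ => ?_) γ fun q τ hτA => ?_
  · refine hτ' γ (F.torOneVanishes_of_notMem_torSupport fun h => hγ (hA _ h)) ?_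
    exact hA'.imp_left fun h h' => hγ (h _ h')
  · rw [add_assoc i, add_comm 1]
    exact hac (q + 1) τ (by rwa [add_comm q, ← zero_add 1])

end GradedFreeResolution

end TorSupport

/-! ### From the degree shift to the regularity bounds. -/

section Regularity

variable {S G : Type*} [CommRing S] [AddCommGroup G] {n : ℕ} {deg : Fin n → G}
variable {r : ℕ} {f : Fin r → MvPolynomial (Fin n) S} {δ : Fin r → G}

theorem le_cohomDim_of_mem_support {p : ℕ} {γ : G}
    (h : γ ∈ localCohomologySupport f δ (polyPiece deg S) p) :
    ((p : ℝ) : EReal) ≤ cohomDim f (MvPolynomial (Fin n) S) := by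
  have hn : Nontrivial (LocalCohomology f (MvPolynomial (Fin n) S) p) := by
    refine nontrivial_localCohomology_of_not_cechVanishing fun hv => ?_
    exact (notMem_localCohomologySupport_iff f δ _ p γ).2 (hv.cechAcyclic _ γ) h
  exact le_iSup₂ (f := fun (p : ℕ)
    (_ : Nontrivial (LocalCohomology f (MvPolynomial (Fin n) S) p)) =>
    ((p : ℝ) : EReal)) p hn

theorem cohomDim_le_of_isField (hS : IsField S) :
    cohomDim f (MvPolynomial (Fin n) S) ≤ ((n : ℝ) : EReal) := by
  refine iSup₂_le fun p hp => ?_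
  by_contra hlt
  have hnp : n < p := by
    rw [not_le] at hlt
    exact_mod_cast hlt
  have := (cechVanishing_mvPolynomial hS (f := f) hnp).subsingleton_localCohomology
  exact not_subsingleton (LocalCohomology f (MvPolynomial (Fin n) S) p) this

variable {M : Type*} [AddCommGroup M] [Module (MvPolynomial (Fin n) S) M] {ℳ : G → AddSubgroup M}

theorem mem_reg_iff {ℓ : ℤ} {γ : G} : γ ∈ reg deg f δ ℳ ℓ ↔
    ∀ c ∈ degMonoid deg, ∀ i : ℕ, ℓ ≤ i → ∀ μ ∈ localCohomologySupport f δ ℳ i,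
      ∀ η ∈ degSums deg i, μ + η ≠ γ + c := by
  simp only [reg, Set.mem_ofPred_eq, Set.mem_iUnion, Set.mem_add, not_exists, not_and,
    ne_eq]

/-- `reg^ℓ(M)` contains `γ` as soon as each `μ` in the support of `H^i(M)` can be shifted to the
support of `H^{i+q}(R)` by some `τ ∈ A q`, and `γ` lies in the corresponding sets. -/
theorem mem_reg_of_shift {A : ℕ → Set G} {ℓ : ℤ} {γ : G}
    (hcd : cohomDim f (MvPolynomial (Fin n) S) ≤ ((n : ℝ) : EReal))
    (hshift : ∀ i, ∀ μ ∈ localCohomologySupport f δ ℳ i, ∃ q, ∃ τ ∈ A q,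
      μ - τ ∈ localCohomologySupport f δ (polyPiece deg S) (i + q))
    (h : ∀ q : ℕ, (((ℓ + q : ℤ) : ℝ) : EReal) ≤ cohomDim f (MvPolynomial (Fin n) S) →
      ∀ τ ∈ A q, ∀ γ' ∈ degSums deg q, γ ∈ reg deg f δ (polyPiece deg S) (ℓ + q) + {τ - γ'}) :
    γ ∈ reg deg f δ ℳ ℓ := by
  classical
  rw [mem_reg_iff]
  rintro c hc i hi μ hμ _ ⟨s, hs, rfl⟩ heq
  obtain ⟨q, τ, hτ, hμτ⟩ := hshift i μ hμ
  have hle := le_cohomDim_of_mem_support hμτ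
  have hiq : i + q ≤ n := by exact_mod_cast hle.trans hcd
  -- As `i + q ≤ n`, there are `q` variables outside `s`. Their degree sum serves as `γ'`, and `s ∪
  -- s'` then gives an element of `𝓔_{i+q}`.
  obtain ⟨s', hs', hq⟩ := Finset.exists_subset_card_eq (s := sᶜ) (n := q) (by
    rw [Finset.card_compl, Fintype.card_fin]; omega)
  have hdisj : Disjoint s s' := disjoint_compl_right.mono_right hs'
  have hcard : (s ∪ s').card = i + q := by rw [Finset.card_union_of_disjoint hdisj, hs, hq]
  -- Since `ℓ + q ≤ i + q ≤ cd`, only the indices of the restricted intersection are used.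
  have hlq : (((ℓ + q : ℤ) : ℝ) : EReal) ≤ cohomDim f (MvPolynomial (Fin n) S) := by
    refine le_trans ?_ hle
    rw [EReal.coe_le_coe_iff]
    exact_mod_cast add_le_add_left hi (q : ℤ)
  obtain ⟨y, hy, _, rfl, rfl⟩ := h q hlq τ hτ (∑ i ∈ s', deg i) ⟨s', hq, rfl⟩
  rw [mem_reg_iff] at hy
  refine hy c hc (i + q) (by push_cast; exact add_le_add_left hi _) _ hμτ _
    ⟨s ∪ s', hcard, rfl⟩ ?_
  rw [Finset.sum_union hdisj]
  have : μ = y + (τ - ∑ i ∈ s', deg i) + c - ∑ i ∈ s, deg i := eq_sub_of_add_eq heq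
  rw [this]
  abel

theorem reg_mono {ℓ ℓ' : ℤ} (h : ℓ ≤ ℓ') : reg deg f δ ℳ ℓ ⊆ reg deg f δ ℳ ℓ' := by
  intro γ hγ
  rw [mem_reg_iff] at *
  exact fun c hc i hi => hγ c hc i (h.trans hi)

theorem add_mem_reg {ℓ : ℤ} {γ c : G} (hγ : γ ∈ reg deg f δ ℳ ℓ) (hc : c ∈ degMonoid deg) :
    γ + c ∈ reg deg f δ ℳ ℓ := by
  intro c' hc'
  rw [add_assoc]
  exact hγ _ (add_mem hc hc')

/-- The sets `reg^ℓ` grow with `ℓ` and are stable under adding `𝓒`; this gives all the second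
inclusions. -/
theorem add_mem_reg_add_singleton {ℓ : ℤ} {a b τ : G} (q : ℕ) (ha : a ∈ reg deg f δ ℳ ℓ)
    (hb : b ∈ {τ} + (degMonoid deg : Set G)) : a + b ∈ reg deg f δ ℳ (ℓ + q) + {τ} := by
  obtain ⟨_, rfl, c, hc, rfl⟩ := hb
  refine ⟨a + c, add_mem_reg (reg_mono (by omega) ha) hc, _, rfl, ?_⟩
  dsimp only
  rw [add_assoc, add_comm c]

/-- The bound for the classical regularity. -/
theorem classicalReg_le_of_shift {A : ℕ → Set G} {T : ℕ → Set G} {ℓ : ℤ} (φ : G ≃+ ℤ)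
    (hA : ∀ q, ∀ τ ∈ A q, ∃ j ≤ q, τ ∈ T j)
    (hshift : ∀ i, ∀ μ ∈ localCohomologySupport f δ ℳ i, ∃ q, ∃ τ ∈ A q,
      μ - τ ∈ localCohomologySupport f δ (polyPiece deg S) (i + q)) :
    classicalReg φ f δ ℳ ℓ ≤ classicalReg φ f δ (polyPiece deg S) ℓ +
      ⨆ (i : ℕ) (γ ∈ T i), (((φ γ - i : ℤ) : ℝ) : EReal) := by
  refine iSup₂_le fun i hi => iSup₂_le fun μ hμ => ?_
  obtain ⟨q, τ, hτ, hμτ⟩ := hshift i μ hμ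
  obtain ⟨j, hj, hτj⟩ := hA q τ hτ
  have h1 : (((φ (μ - τ) + (i + q : ℕ) : ℤ) : ℝ) : EReal) ≤
      classicalReg φ f δ (polyPiece deg S) ℓ :=
    le_iSup₂_of_le (i + q) (by push_cast; omega) (le_iSup₂_of_le (μ - τ) hμτ le_rfl)
  have h2 : (((φ τ - j : ℤ) : ℝ) : EReal) ≤
      ⨆ (i : ℕ) (γ ∈ T i), (((φ γ - i : ℤ) : ℝ) : EReal) :=
    le_iSup_of_le j (le_iSup₂_of_le τ hτj le_rfl)
  -- `μ + i = ((μ - τ) + (i + q)) + (τ - q)`, and `τ - q ≤ τ - j` because `j ≤ q`.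
  refine le_trans ?_ (add_le_add h1 h2)
  rw [← EReal.coe_add, EReal.coe_le_coe_iff, ← Int.cast_add, Int.cast_le, map_sub]
  push_cast
  omega

end Regularity

end MultigradedReg

end

/-! ### The main theorem. -/

open MultigradedReg in
theorem mainTheorem11 {S : Type*} [CommRing S] [IsNoetherianRing S]
    {G : Type*} [AddCommGroup G] [DecidableEq G]
    {n : ℕ} (deg : Fin n → G)
    -- the ideal `B ⊆ (X_1, …, X_n)` and homogeneous generators `f j` of it, of degrees `δ j`
    (B : Ideal (MvPolynomial (Fin n) S)) (hBX : B ≤ irrelevant S n)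
    {r : ℕ} (f : Fin r → MvPolynomial (Fin n) S) (δ : Fin r → G)
    (hf : ∀ j, MvPolynomial.IsWeightedHomogeneous deg (f j) (δ j))
    (hfB : Ideal.span (Set.range f) = B)
    -- every monomial of degree `0` other than `1` lies in the radical of `B`
    (hdeg : ∀ a : Fin n →₀ ℕ, a ≠ 0 → Finsupp.weight deg a = 0 →
      MvPolynomial.monomial a (1 : S) ∈ B.radical)
    -- the finitely generated graded module `M`
    {M : Type*} [AddCommGroup M] [Module (MvPolynomial (Fin n) S) M]
    [Module.Finite (MvPolynomial (Fin n) S) M]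
    (ℳ : G → AddSubgroup M) [DirectSum.Decomposition ℳ]
    [SetLike.GradedSMul (MvPolynomial.weightedHomogeneousSubmodule S deg) ℳ]
    -- a graded free resolution of `M`, which computes `Tor^R(M, S)`
    (F : GradedFreeResolution (S := S) deg ℳ)
    (ℓ : ℤ) :
    (cohomDim f (MvPolynomial (Fin n) S) ≤ ((n : ℝ) : EReal) →
      ((⋂ (i : ℕ) (j : ℕ) (_ : j ≤ i) (γ ∈ F.torSupport j) (γ' ∈ degSums deg i),
            reg deg f δ (polyPiece deg S) (ℓ + i) + {γ - γ'})
          ⊆ reg deg f δ ℳ ℓ ∧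
        reg deg f δ (polyPiece deg S) ℓ +
            (⋂ (i : ℕ) (j : ℕ) (_ : j ≤ i) (γ ∈ F.torSupport j) (γ' ∈ degSums deg i),
              {γ - γ'} + (degMonoid deg : Set G))
          ⊆ ⋂ (i : ℕ) (j : ℕ) (_ : j ≤ i) (γ ∈ F.torSupport j) (γ' ∈ degSums deg i),
              reg deg f δ (polyPiece deg S) (ℓ + i) + {γ - γ'}) ∧
      ((⋂ (i : ℕ) (_ : (((ℓ + i : ℤ) : ℝ) : EReal) ≤ cohomDim f (MvPolynomial (Fin n) S))
            (j : ℕ) (_ : j ≤ i) (γ ∈ F.torSupport j) (γ' ∈ degSums deg i),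
            reg deg f δ (polyPiece deg S) (ℓ + i) + {γ - γ'})
          ⊆ reg deg f δ ℳ ℓ ∧
        reg deg f δ (polyPiece deg S) ℓ +
            (⋂ (i : ℕ) (_ : (((ℓ + i : ℤ) : ℝ) : EReal) ≤ cohomDim f (MvPolynomial (Fin n) S))
              (j : ℕ) (_ : j ≤ i) (γ ∈ F.torSupport j) (γ' ∈ degSums deg i),
              {γ - γ'} + (degMonoid deg : Set G))
          ⊆ ⋂ (i : ℕ) (_ : (((ℓ + i : ℤ) : ℝ) : EReal) ≤ cohomDim f (MvPolynomial (Fin n) S))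
              (j : ℕ) (_ : j ≤ i) (γ ∈ F.torSupport j) (γ' ∈ degSums deg i),
              reg deg f δ (polyPiece deg S) (ℓ + i) + {γ - γ'})) ∧
    (IsField S →
      (⋂ (i : ℕ) (γ ∈ F.torSupport i) (γ' ∈ degSums deg i),
          reg deg f δ (polyPiece deg S) (ℓ + i) + {γ - γ'})
        ⊆ reg deg f δ ℳ ℓ ∧
      reg deg f δ (polyPiece deg S) ℓ +
          (⋂ (i : ℕ) (γ ∈ F.torSupport i) (γ' ∈ degSums deg i),
            {γ - γ'} + (degMonoid deg : Set G))
        ⊆ ⋂ (i : ℕ) (γ ∈ F.torSupport i) (γ' ∈ degSums deg i),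
            reg deg f δ (polyPiece deg S) (ℓ + i) + {γ - γ'}) ∧
    (∀ φ : G ≃+ ℤ, (∀ k, φ (deg k) = 1) →
      classicalReg φ f δ ℳ ℓ ≤ classicalReg φ f δ (polyPiece deg S) ℓ +
        ⨆ (i : ℕ) (γ ∈ F.torSupport i), (((φ γ - i : ℤ) : ℝ) : EReal)) := by
  subst hfB
  have hℳ := GradedProjections.ofDecomposition (S := S) (deg := deg) ℳ
  have hshift : ∀ {A : ℕ → Set G}, (∀ k, F.torSupport k ⊆ A k) →
      ((∀ k, A k ⊆ A (k + 1)) ∨ IsField S) → ∀ i, ∀ μ ∈ localCohomologySupport f δ ℳ i,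
      ∃ q, ∃ τ ∈ A q, μ - τ ∈ localCohomologySupport f δ (polyPiece deg S) (i + q) := by
    intro A hA hA' i μ hμ
    by_contra! hc
    refine (notMem_localCohomologySupport_iff f δ ℳ i μ).2 ?_ hμ
    exact F.cechAcyclic_of_poly hℳ hf hdeg hA hA' fun q τ hτ =>
      (notMem_localCohomologySupport_iff f δ _ _ _).1 (hc q τ hτ)
  -- Unions over `j ≤ q` are increasing in `q`, as required over a general `S`; over a field the
  -- sets `T_q` themselves are used.
  have hshift₁ := hshift (A := fun q => ⋃ j ≤ q, F.torSupport j)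
    (fun k _ h => Set.mem_iUnion₂.2 ⟨k, le_rfl, h⟩)
    (Or.inl fun k => Set.biUnion_subset_biUnion_left fun j hj => Nat.le_succ_of_le hj)
  refine ⟨fun hcd => ⟨⟨fun x hx => ?_, ?_⟩, ⟨fun x hx => ?_, ?_⟩⟩, fun hS => ⟨fun x hx => ?_, ?_⟩,
    fun φ _ => ?_⟩
  · refine mem_reg_of_shift hcd hshift₁ fun q _ τ hτ γ' hγ' => ?_
    obtain ⟨j, hj, hτ⟩ := Set.mem_iUnion₂.1 hτ
    simp only [Set.mem_iInter] at hx
    exact hx q j hj τ hτ γ' hγ'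
  · rintro _ ⟨a, ha, b, hb, rfl⟩
    simp only [Set.mem_iInter] at hb ⊢
    exact fun i j hj γ hγ γ' hγ' => add_mem_reg_add_singleton i ha (hb i j hj γ hγ γ' hγ')
  · refine mem_reg_of_shift hcd hshift₁ fun q hq τ hτ γ' hγ' => ?_
    obtain ⟨j, hj, hτ⟩ := Set.mem_iUnion₂.1 hτ
    simp only [Set.mem_iInter] at hx
    exact hx q hq j hj τ hτ γ' hγ'
  · rintro _ ⟨a, ha, b, hb, rfl⟩
    simp only [Set.mem_iInter] at hb ⊢
    exact fun i hi j hj γ hγ γ' hγ' => add_mem_reg_add_singleton i ha (hb i hi j hj γ hγ γ' hγ')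
  · refine mem_reg_of_shift (cohomDim_le_of_isField hS)
      (hshift (fun _ => subset_rfl) (Or.inr hS)) fun q _ τ hτ γ' hγ' => ?_
    simp only [Set.mem_iInter] at hx
    exact hx q τ hτ γ' hγ'
  · rintro _ ⟨a, ha, b, hb, rfl⟩
    simp only [Set.mem_iInter] at hb ⊢
    exact fun i γ hγ γ' hγ' => add_mem_reg_add_singleton i ha (hb i γ hγ γ' hγ')
  · exact classicalReg_le_of_shift φ (fun q τ hτ => by simpa using hτ) hshift₁
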